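/- Let $P\subseteq\{3,4,5,\dots\}$ be a nonempty set and let $L_P=\{E_n: n\ge 1\}\cup\{<_n: n\in P\}$ be the relational language in which $E_n$ and $<_n$ have arity $2n$. Let $\mathcal K_P$ be the class of all finite $L_P$-structures $C$ such that for every $n\ge 1$ the relation $E_n(\bar x,\bar y)$ is an equivalence relation on the set $\binom{C}{n}$ of unordered $n$-element subsets of $C$ (viewed as a relation between $n$-tuples without repetitions; it fails for tuples with repetitions), and for every $n\in P$ the relation $<_n$ (also holding only between tuples without repetitions) is a strict linear order on the set $\binom{C}{n}/E_n$ of $E_n$-classes. Let $M$ be the generic structure of $\mathcal K_P$, i.e. its Fraïssé limit: the countable ultrahomogeneous $L_P$-structure whose age is $\mathcal K_P$. Automorphism groups carry the topology of pointwise convergence. A topological group $G$ is amenable if every $G$-flow (a nonempty compact Hausdorff space with a continuous $G$-action) has an invariant (regular) Borel probability measure, and extremely amenable if every $G$-flow has a fixed point. A structure $U$ has Hrushovski's extension property if for every finite family of isomorphisms between finite substructures of $U$ there is a finite substructure $F$ of $U$ containing all these substructures such that every member of the family extends to an automorphism of $F$. Then: 1. the group $\mathrm{Aut}(M)$ is amenable;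 2. $M$ does not have Hrushovski's extension property; 3. there is no linear order $<$ on $M$ such that $(M,<)$ is ultrahomogeneous and $\mathrm{Aut}(M,<)$ is extremely amenable; 4. let $M'$ be an expansion of $M$ to a relational language containing $L_P$ which is precompact (every member of $\mathcal K_P$ has only finitely many expansions in the age of $M'$) and has quantifier elimination. If $\mathrm{Aut}(M')$ is extremely amenable, then for every $n\in P$ with $2n\notin P$ the structure $M'$ has no $<_n$-increasing sequence of type $\mathbb Z/4\mathbb Z$, that is, there are no $n$-tuples $\bar a_1,\dots,\bar a_6$ in $M$ such that - the $2n$-tuples $\bar a_1\bar a_2$, $\bar a_2\bar a_3$ and $\bar a_3\bar a_4$ have the same isomorphism type in $M'$, - the $4n$-tuples $\bar a_1\bar a_2\bar a_3\bar a_4$ and $\bar a_3\bar a_4\bar a_5\bar a_6$ have the same isomorphism type in $M'$, and - $\bar a_1\bar a_2$ and $\bar a_5\bar a_6$ are $E_{2n}$-equivalent, but not $E_{2n}$-equivalent to $\bar a_3\bar a_4$. (Two tuples have the same isomorphism type in $M'$ if mapping each entry of the first to the corresponding entry of the second is an isomorphism between the substructures of $M'$ that they form.) -/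

import Mathlib

open FirstOrder FirstOrder.Language

universe u v w x y

namespace GenericOrders

/-! ### Automorphism groups as topological groups -/

/-- The automorphism group of a first-order structure. -/
abbrev Aut (L : FirstOrder.Language.{u, v}) (M : Type w) [L.Structure M] : Type w := M ≃[L] M

instance autGroup (L : FirstOrder.Language.{u, v}) (M : Type w) [L.Structure M] : Group (Aut L M) where
  mul g h := g.comp h
  one := FirstOrder.Language.Equiv.refl L M
  inv g := g.symm
  mul_assoc _ _ _ := rfl
  one_mul _ := rfl
  mul_one _ := rfl
  inv_mul_cancel g := FirstOrder.Language.Equiv.symm_comp_self g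

/-- The topology of pointwise convergence, the underlying set of `M` being discrete: the sets
`{g | g a = b}` form a subbase. -/
instance autTopology (L : FirstOrder.Language.{u, v}) (M : Type w) [L.Structure M] :
    TopologicalSpace (Aut L M) :=
  TopologicalSpace.generateFrom {U | ∃ a b : M, U = {g : Aut L M | g a = b}}

/-- `G` is amenable: every `G`-flow (a nonempty compact Hausdorff space with a continuous action
of `G`) carries an invariant (regular) Borel probability measure. -/
def IsAmenable (G : Type w) [Group G] [TopologicalSpace G] : Prop :=
  ∀ (X : Type x) [TopologicalSpace X] [CompactSpace X] [T2Space X] [Nonempty X]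
    [MeasurableSpace X] [BorelSpace X] [MulAction G X] [ContinuousSMul G X],
    ∃ μ : MeasureTheory.Measure X, MeasureTheory.IsProbabilityMeasure μ ∧ μ.Regular ∧
      ∀ g : G, μ.map (fun p => g • p) = μ

/-- `G` is extremely amenable: every `G`-flow has a fixed point. -/
def IsExtremelyAmenable (G : Type w) [Group G] [TopologicalSpace G] : Prop :=
  ∀ (X : Type x) [TopologicalSpace X] [CompactSpace X] [T2Space X] [Nonempty X]
    [MulAction G X] [ContinuousSMul G X], ∃ p : X, ∀ g : G, g • p = p

/-! ### Model-theoretic notions -/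

/-- Hrushovski's extension property: for every finite family of isomorphisms between finite
substructures of `M` there is a finite substructure `F` of `M` containing all these substructures
such that every member of the family extends to an automorphism of `F`. -/
def HrushovskiExtension (L : FirstOrder.Language.{u, v}) (M : Type w) [L.Structure M] : Prop :=
  ∀ (k : ℕ) (f : Fin k → (M ≃ₚ[L] M)), (∀ i, Finite (f i).dom) →
    ∃ F : L.Substructure M, Finite F ∧
      ∀ i, (f i).dom ≤ F ∧ (f i).cod ≤ F ∧
        ∃ g : F ≃[L] F, ∀ (a : F) (ha : (a : M) ∈ (f i).dom),
          ((g a : F) : M) = ((f i).toEquiv ⟨a, ha⟩ : M)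

/-- `M` has quantifier elimination: every formula is equivalent in `M` (equivalently, modulo the
complete theory of `M`) to a quantifier-free formula in the same free variables. -/
def HasQE (L : FirstOrder.Language.{u, v}) (M : Type w) [L.Structure M] : Prop :=
  ∀ (k : ℕ) (φ : L.Formula (Fin k)), ∃ ψ : L.Formula (Fin k),
    BoundedFormula.IsQF ψ ∧ ∀ a : Fin k → M, φ.Realize a ↔ ψ.Realize a

/-- For an expansion of the `L`-structure `M` to an `L'`-structure along `φ : L →ᴸ L'`:
every member of the age of `M` has only finitely many expansions in the age of the expanded
structure. -/
def IsPrecompactExpansion {L : FirstOrder.Language.{u, v}} {L' : FirstOrder.Language.{x, y}} (φ : L →ᴸ L')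
    (M : Type w) [L.Structure M] [L'.Structure M] : Prop :=
  ∀ A ∈ L.age M,
    {S : L'.Structure A | @LHom.IsExpansionOn L L' φ A A.str S ∧
      (⟨A, S⟩ : CategoryTheory.Bundled.{w} L'.Structure) ∈ L'.age M}.Finite

/-- The tuples `a` and `b` have the same isomorphism type: `a i ↦ b i` is a well-defined
isomorphism between the substructures generated by the two tuples. -/
def SameIsoType (L : FirstOrder.Language.{u, v}) {M : Type w} [L.Structure M] {k : ℕ}
    (a b : Fin k → M) : Prop :=
  ∃ e : Substructure.closure L (Set.range a) ≃[L] Substructure.closure L (Set.range b),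
    ∀ i, ((e ⟨a i, Substructure.subset_closure (Set.mem_range_self i)⟩ :
      Substructure.closure L (Set.range b)) : M) = b i

/-- The expansion of an `L`-structure by a linear order. -/
abbrev orderExpansion (L : FirstOrder.Language.{u, v}) (M : Type w) [L.Structure M] (o : LinearOrder M) :
    (L.sum FirstOrder.Language.order).Structure M :=
  letI : FirstOrder.Language.order.Structure M := @FirstOrder.Language.orderStructure M o.toLE
  FirstOrder.Language.sumStructure L FirstOrder.Language.order M

/-! ### The language, the class of finite structures -/

/-- The symbols `E_n` (`n > 0`) and `<_n` (`n ∈ P`), both of arity `n + n`. -/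
inductive Rel (P : Set ℕ) : ℕ → Type
  | E (n : ℕ) (hn : 0 < n) : Rel P (n + n)
  | lt (n : ℕ) (hn : n ∈ P) : Rel P (n + n)

/-- The relational language `{E_n : n > 0} ∪ {<_n : n ∈ P}`. -/
def langP (P : Set ℕ) : FirstOrder.Language.{0, 0} := ⟨fun _ => Empty, Rel P⟩

instance langP_isRelational (P : Set ℕ) : (langP P).IsRelational :=
  fun _ => inferInstanceAs (IsEmpty Empty)

/-- `E_n(x, y)` for `n`-tuples `x`, `y`. -/
def relE (P : Set ℕ) {C : Type w} [(langP P).Structure C] (n : ℕ) (hn : 0 < n)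
    (s t : Fin n → C) : Prop :=
  Structure.RelMap (L := langP P) (Rel.E n hn : (langP P).Relations (n + n)) (Fin.append s t)

/-- `s <_n t` for `n`-tuples `s`, `t`. -/
def relLt (P : Set ℕ) {C : Type w} [(langP P).Structure C] (n : ℕ) (hn : n ∈ P)
    (s t : Fin n → C) : Prop :=
  Structure.RelMap (L := langP P) (Rel.lt n hn : (langP P).Relations (n + n)) (Fin.append s t)

/-- `R` is (the lift to `n`-tuples without repetitions of) an equivalence relation on the set of
unordered `n`-element subsets of `C`; it does not hold for tuples with repetitions. -/
structure IsEquivOnSubsets {C : Type w} {n : ℕ} (R : (Fin n → C) → (Fin n → C) → Prop) :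
    Prop where
  inj : ∀ s t, R s t → Function.Injective s ∧ Function.Injective t
  perm : ∀ s, Function.Injective s → ∀ σ : Equiv.Perm (Fin n), R s (s ∘ σ)
  symm : ∀ s t, R s t → R t s
  trans : ∀ s t r, R s t → R t r → R s r

/-- `lt` is (the lift to `n`-tuples without repetitions of) a strict linear order on the set of
classes of `R`. -/
structure IsLinearOrderOnClasses {C : Type w} {n : ℕ} (R lt : (Fin n → C) → (Fin n → C) → Prop) :
    Prop where
  inj : ∀ s t, lt s t → Function.Injective s ∧ Function.Injective t
  respects : ∀ s t p q, R s t → R p q → lt s p → lt t q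
  irrefl : ∀ s t, lt s t → ¬ R s t
  trans : ∀ s t r, lt s t → lt t r → lt s r
  total : ∀ s t, Function.Injective s → Function.Injective t → ¬ R s t → lt s t ∨ lt t s

/-- The class of all finite structures in which each `E_n` is an equivalence relation on the set
of unordered `n`-element subsets, and each `<_n`, `n ∈ P`, is a linear order on the set of
`E_n`-classes. -/
def classK (P : Set ℕ) (hP : ∀ n ∈ P, 3 ≤ n) :
    Set (CategoryTheory.Bundled.{w} (langP P).Structure) :=
  {C | Finite C ∧
    (∀ (n : ℕ) (hn : 0 < n), IsEquivOnSubsets (relE P (C := C) n hn)) ∧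
    (∀ (n : ℕ) (hn : n ∈ P), IsLinearOrderOnClasses
      (relE P (C := C) n (Nat.lt_of_lt_of_le (by decide) (hP n hn))) (relLt P (C := C) n hn))}

/-- In an `L'`-expansion of the `langP P`-structure `M`, the six `n`-tuples `a 0, …, a 5` form a
`<_n`-increasing sequence of type `ℤ/4ℤ`; isomorphism types are taken in `L'`, concatenation of
tuples is `Fin.append`. -/
def IsIncreasingZ4 (P : Set ℕ) (L' : FirstOrder.Language.{x, y}) {M : Type w} [(langP P).Structure M]
    [L'.Structure M] (n : ℕ) (hn : 0 < n) (a : Fin 6 → (Fin n → M)) : Prop :=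
  SameIsoType L' (Fin.append (a 0) (a 1)) (Fin.append (a 1) (a 2)) ∧
  SameIsoType L' (Fin.append (a 1) (a 2)) (Fin.append (a 2) (a 3)) ∧
  SameIsoType L' (Fin.append (Fin.append (a 0) (a 1)) (Fin.append (a 2) (a 3)))
    (Fin.append (Fin.append (a 2) (a 3)) (Fin.append (a 4) (a 5))) ∧
  relE P (n + n) (Nat.add_pos_left hn n) (Fin.append (a 0) (a 1)) (Fin.append (a 4) (a 5)) ∧
  ¬ relE P (n + n) (Nat.add_pos_left hn n) (Fin.append (a 0) (a 1)) (Fin.append (a 2) (a 3))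

end GenericOrders

open GenericOrders

/-! Amenability rests on an approximate substitute for Hrushovski's property. By the Riesz
representation theorem (`exists_invariant_measure`) it suffices, given finitely many group elements,
finitely many functions and a tolerance, to find a finite family of points with almost invariant
averages. Fix `p₀` in the flow. Up to a small error `f (g⁻¹ • p₀)` depends only on the restriction
of `g` to a finite set `A`. Hence one needs finitely many copies of a finite `B ⊇ A` in `M` over
which bounded functions of the copy of `A` have almost the same average for finitely many isomorphic
injections `A → B`.

The copies live in the finite set `B × (Set B → ZMod K)`. A set that projects injectively to `B` is
labelled by the sum of its valuations at its projection. Valuations can be shifted freely as long as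
all sums are kept, so tuples with injective projections and equal labels on their subsets are
conjugate under label preserving permutations (`exists_perm_valuationLabel`). An average over these
permutations therefore depends only on the labels. Isomorphic injections need not have equal labels,
however: only coincidences of labels, and their order at sizes in `P`, are preserved. Ramsey's
theorem supplies label values for which the average depends, up to a small error, only on the order
type of the labels (`exists_bound_strictMono_approx`). At sizes outside `P`, where the order of
labels has no meaning in `M`, one also averages over all permutations of the labels
(`exists_relabel`). Both devices meet in `exists_almost_invariant_family`.

Hrushovski's property fails because some `n`-tuple is isomorphic to a `<_n`-larger one, and an
automorphism of a finite structure cannot move a tuple strictly up a linear order.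

The last two claims use one obstruction: an extremely amenable group fixes a tournament on the
classes of any invariant equivalence relation, so none of its elements interchanges two classes
(`equiv_smul_of_equiv_smul_smul`). In an ultrahomogeneous expansion by a linear order this first
forces the `E_1`-classes to be convex. Then three `E_1`-classes, each containing pairs from two
given `E_2`-classes, yield an automorphism interchanging these two `E_2`-classes. In a precompact
expansion with quantifier elimination, which is again ultrahomogeneous, a sequence of type `ℤ/4ℤ`
directly gives an automorphism interchanging two `E_{2n}`-classes. -/

namespace GenericOrders

/-! ### A criterion for the existence of an invariant measure -/

section InvariantMeasure

open Filter Topology MeasureTheory CompactlySupported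

/-- The uniform average of `f` over a finite family of points. -/
noncomputable def average {X : Type*} {m : ℕ} (y : Fin m → X) (f : X → ℝ) : ℝ :=
  (∑ i, f (y i)) / m

lemma average_add {X : Type*} {m : ℕ} (y : Fin m → X) (f g : X → ℝ) :
    average y (fun p => f p + g p) = average y f + average y g := by
  simp [average, Finset.sum_add_distrib, add_div]

lemma average_mul {X : Type*} {m : ℕ} (y : Fin m → X) (c : ℝ) (f : X → ℝ) :
    average y (fun p => c * f p) = c * average y f := by
  simp [average, ← Finset.mul_sum, mul_div_assoc]

lemma average_nonneg {X : Type*} {m : ℕ} (y : Fin m → X) {f : X → ℝ} (hf : ∀ p, 0 ≤ f p) :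
    0 ≤ average y f :=
  div_nonneg (Finset.sum_nonneg fun _ _ => hf _) (Nat.cast_nonneg _)

lemma average_one {X : Type*} {m : ℕ} (hm : 0 < m) (y : Fin m → X) :
    average y (fun _ => 1) = 1 := by
  have : (m : ℝ) ≠ 0 := by positivity
  simp [average, this]

lemma abs_average_le {X : Type*} {m : ℕ} (hm : 0 < m) (y : Fin m → X) {f : X → ℝ} {C : ℝ}
    (hf : ∀ p, |f p| ≤ C) : |average y f| ≤ C := by
  have h : (0 : ℝ) < m := by positivity
  rw [average, abs_div, abs_of_pos h, div_le_iff₀ h]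
  calc |∑ i, f (y i)| ≤ ∑ i, |f (y i)| := Finset.abs_sum_le_sum_abs _ _
    _ ≤ ∑ _i : Fin m, C := Finset.sum_le_sum fun _ _ => hf _
    _ = C * m := by simp [mul_comm]

/-- A positive normalized functional invariant under `G` is integration against an invariant
regular probability measure. -/
lemma exists_invariant_measure_of_functional {G : Type*} [Group G] {X : Type*} [TopologicalSpace X]
    [CompactSpace X] [T2Space X] [MeasurableSpace X] [BorelSpace X] [MulAction G X]
    (hcont : ∀ g : G, Continuous fun p : X => g • p)
    (Λ : C_c(X, ℝ) →ₚ[ℝ] ℝ)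
    (hone : ∀ f : C_c(X, ℝ), (∀ p, f p = 1) → Λ f = 1)
    (hinv : ∀ (g : G) (f f' : C_c(X, ℝ)), (∀ p, f' p = f (g • p)) → Λ f' = Λ f) :
    ∃ μ : Measure X, IsProbabilityMeasure μ ∧ μ.Regular ∧
      ∀ g : G, μ.map (fun p => g • p) = μ := by
  let μ := RealRMK.rieszMeasure Λ
  refine ⟨μ, ⟨?_⟩, inferInstance, fun g => ?_⟩
  · let o : C_c(X, ℝ) := ⟨1, HasCompactSupport.of_compactSpace 1⟩
    have h := RealRMK.integral_rieszMeasure Λ o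
    rw [hone o fun p => rfl] at h
    have h2 : ∫ p, o p ∂(RealRMK.rieszMeasure Λ) = (RealRMK.rieszMeasure Λ).real Set.univ := by
      have : ∀ p, o p = 1 := fun p => rfl
      simp [this]
    rw [h2, measureReal_def] at h
    exact (ENNReal.toReal_eq_one_iff _).1 h
  · let e : X ≃ₜ X :=
      { toEquiv := MulAction.toPerm g
        continuous_toFun := hcont g
        continuous_invFun := hcont g⁻¹ }
    have : (μ.map (fun p => g • p)).Regular := Measure.Regular.map (μ := μ) e
    refine Measure.ext_of_integral_eq_on_compactlySupported fun f => ?_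
    rw [integral_map (hcont g).aemeasurable (map_continuous f).aestronglyMeasurable]
    let f' : C_c(X, ℝ) := ⟨⟨fun p => f (g • p), f.continuous.comp (hcont g)⟩,
      HasCompactSupport.of_compactSpace _⟩
    have h1 := RealRMK.integral_rieszMeasure Λ f'
    rw [hinv g f f' fun p => rfl] at h1
    exact h1.trans (RealRMK.integral_rieszMeasure Λ f).symm

/-- If there are finite families of points whose averages are almost invariant, then there is an
invariant measure. -/
theorem exists_invariant_measure {G : Type*} [Group G] {X : Type*} [TopologicalSpace X]
    [CompactSpace X] [T2Space X] [MeasurableSpace X] [BorelSpace X] [MulAction G X]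
    (hcont : ∀ g : G, Continuous fun p : X => g • p)
    (h : ∀ (F : Finset G) (Φ : Finset C_c(X, ℝ)) (ε : ℝ), 0 < ε →
      ∃ (m : ℕ) (_ : 0 < m) (y : Fin m → X), ∀ s ∈ F, ∀ f ∈ Φ,
        |average y (fun p => f (s • p)) - average y f| ≤ ε) :
    ∃ μ : Measure X, IsProbabilityMeasure μ ∧ μ.Regular ∧
      ∀ g : G, μ.map (fun p => g • p) = μ := by
  classical
  let J := Finset G × Finset C_c(X, ℝ) × ℕ
  have h' : ∀ j : J, ∃ (m : ℕ) (_ : 0 < m) (y : Fin m → X), ∀ s ∈ j.1, ∀ f ∈ j.2.1,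
      |average y (fun p => f (s • p)) - average y f| ≤ 1 / ((j.2.2 : ℝ) + 1) :=
    fun j => h j.1 j.2.1 _ (by positivity)
  choose m hm y hy using h'
  -- Each index is a finite list of requirements together with a precision. Along an ultrafilter
  -- refining `atTop` all bounded averages converge, and every single requirement eventually holds
  -- with error tending to zero.
  let U : Ultrafilter J := Ultrafilter.of atTop
  have hU : (U : Filter J) ≤ atTop := Ultrafilter.of_le _
  have hlim : ∀ f : C_c(X, ℝ), ∃ l : ℝ, Tendsto (fun j => average (y j) f) U (𝓝 l) := by
    intro f
    obtain ⟨C, hC⟩ : ∃ C, ∀ p, |f p| ≤ C := by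
      obtain ⟨C, hC⟩ := (isCompact_range f.continuous).isBounded.exists_norm_le
      exact ⟨C, fun p => hC _ (Set.mem_range_self p)⟩
    have hK : IsCompact (Set.Icc (-C) C) := isCompact_Icc
    obtain ⟨l, -, hl⟩ := hK.ultrafilter_le_nhds (U.map fun j => average (y j) f) (by
      rw [Ultrafilter.coe_map, le_principal_iff, mem_map]
      exact Filter.univ_mem' fun j => abs_le.1 (abs_average_le (hm j) (y j) hC))
    exact ⟨l, hl⟩
  choose l hl using hlim
  have hadd : ∀ f g, l (f + g) = l f + l g := fun f g => by
    refine tendsto_nhds_unique (hl (f + g)) (((hl f).add (hl g)).congr fun j => ?_)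
    exact (average_add (y j) f g).symm
  have hsmul : ∀ (c : ℝ) f, l (c • f) = c * l f := fun c f => by
    refine tendsto_nhds_unique (hl (c • f)) (((hl f).const_mul c).congr fun j => ?_)
    exact (average_mul (y j) c f).symm
  have hnonneg : ∀ f : C_c(X, ℝ), 0 ≤ f → 0 ≤ l f := fun f hf =>
    ge_of_tendsto (hl f) (Eventually.of_forall fun j => average_nonneg (y j) fun p => hf p)
  let Λ₀ : C_c(X, ℝ) →ₗ[ℝ] ℝ :=
    { toFun := l
      map_add' := hadd
      map_smul' := hsmul }
  let Λ : C_c(X, ℝ) →ₚ[ℝ] ℝ := PositiveLinearMap.mk₀ Λ₀ hnonneg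
  refine exists_invariant_measure_of_functional hcont Λ (fun f hf => ?_) fun g f f' hff' => ?_
  · refine tendsto_nhds_unique (hl f) (tendsto_const_nhds.congr fun j => ?_)
    rw [show (f : X → ℝ) = fun _ => 1 from funext hf, average_one (hm j)]
  · have hdiff : Tendsto (fun j => average (y j) f' - average (y j) f) U (𝓝 (l f' - l f)) :=
      (hl f').sub (hl f)
    have hzero : Tendsto (fun j => average (y j) f' - average (y j) f) U (𝓝 0) := by
      have h0 : Tendsto (fun j : J => j.2.2) U atTop := tendsto_atTop.2 fun b => by
        filter_upwards [hU (mem_atTop ((∅, ∅, b) : J))] with j hj using hj.2.2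
      have h1 := (tendsto_one_div_add_atTop_nhds_zero_nat (𝕜 := ℝ)).comp h0
      refine squeeze_zero_norm' ?_ h1
      filter_upwards [hU (mem_atTop (({g}, {f}, 0) : J))] with j hj
      have := hy j g (hj.1 (by simp)) f (hj.2.1 (by simp))
      rwa [show (f' : X → ℝ) = fun p => f (g • p) from funext hff']
    exact sub_eq_zero.1 (tendsto_nhds_unique hdiff hzero)

end InvariantMeasure

/-! ### Ramsey's theorem -/

section Ramsey

open Filter

/-- **Ramsey's theorem** for `r`-element subsets of an infinite set of natural numbers. -/
theorem exists_infinite_homogeneous {κ : Type*} [Finite κ] (r : ℕ) (S : Set ℕ) (hS : S.Infinite)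
    (c : Finset ℕ → κ) : ∃ H ⊆ S, H.Infinite ∧
      ∃ k, ∀ s : Finset ℕ, (s : Set ℕ) ⊆ H → s.card = r → c s = k := by
  classical
  induction r generalizing S c with
  | zero =>
    refine ⟨S, subset_rfl, hS, c ∅, fun s _ hs => ?_⟩
    rw [Finset.card_eq_zero.1 hs]
  | succ r ih =>
    -- Induction applied to `t ↦ c (insert a t)` makes the colour constant once the least element
    -- `a` is fixed. Iterating gives a sequence on which the colour depends only on the minimum; the
    -- pigeonhole principle then fixes it.
    have step : ∀ T : {T : Set ℕ // T.Infinite}, ∃ (a : ℕ) (H : {T : Set ℕ // T.Infinite}) (k : κ),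
        a ∈ T.1 ∧ H.1 ⊆ T.1 ∧ (∀ b ∈ H.1, a < b) ∧
        ∀ t : Finset ℕ, (t : Set ℕ) ⊆ H.1 → t.card = r → c (insert a t) = k := by
      intro T
      obtain ⟨a, ha⟩ := T.2.nonempty
      have hT : (T.1 ∩ Set.Ioi a).Infinite := by
        have : T.1 \ Set.Iic a = T.1 ∩ Set.Ioi a := by ext; simp
        rw [← this]
        exact T.2.sdiff (Set.finite_Iic a)
      obtain ⟨H, hHT, hH, k, hk⟩ := ih _ hT fun t => c (insert a t)
      exact ⟨a, ⟨H, hH⟩, k, ha, fun b hb => (hHT hb).1, fun b hb => (hHT hb).2, hk⟩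
    choose a next k ha hsub hlt hk using step
    let T : ℕ → {T : Set ℕ // T.Infinite} := fun i => next^[i] ⟨S, hS⟩
    have hT : ∀ i, T (i + 1) = next (T i) := fun i => Function.iterate_succ_apply' _ _ _
    have hanti : Antitone fun i => (T i).1 :=
      antitone_nat_of_succ_le fun i => by rw [hT]; exact hsub _
    have hmono : StrictMono fun i => a (T i) :=
      strictMono_nat_of_lt_succ fun i => hlt (T i) _ (by rw [← hT]; exact ha _)
    obtain ⟨κ₀, hκ⟩ := Finite.exists_infinite_fiber fun i => k (T i)
    rw [Set.infinite_coe_iff] at hκ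
    refine ⟨(fun i => a (T i)) '' ((fun i => k (T i)) ⁻¹' {κ₀}), ?_,
      hκ.image hmono.injective.injOn, κ₀, fun s hs hcard => ?_⟩
    · rintro _ ⟨i, -, rfl⟩
      exact hanti (Nat.zero_le i) (ha _)
    · have hne : s.Nonempty := by rw [← Finset.card_pos]; omega
      obtain ⟨i, hi, hmin⟩ := hs (s.min'_mem hne)
      have hmin : a (T i) = s.min' hne := hmin
      rw [← Finset.insert_erase (s.min'_mem hne), ← hmin]
      rw [← (show k (T i) = κ₀ from hi)]
      refine hk (T i) _ (fun b hb => ?_) ?_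
      · rw [Finset.coe_erase] at hb
        obtain ⟨j, -, rfl⟩ := hs hb.1
        have hij : a (T i) < a (T j) :=
          lt_of_le_of_ne (hmin ▸ s.min'_le _ hb.1) fun h => hb.2 h.symm
        rw [← hT]
        exact hanti (Nat.succ_le_of_lt (hmono.lt_iff_lt.1 hij)) (ha _)
      · rw [hmin, Finset.card_erase_of_mem (s.min'_mem hne), hcard, Nat.add_sub_cancel]

/-- A finite family of natural numbers factors through an increasing sequence of prescribed
length, and so does every family with the same order type, with the same index map. -/
lemma exists_strictMono_factorization {I : Type*} [Fintype I] (p q : I → ℕ)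
    (h : ∀ i j, p i < p j ↔ q i < q j) :
    ∃ (f : I → Fin (Fintype.card I)) (s t : Fin (Fintype.card I) → ℕ),
      StrictMono s ∧ StrictMono t ∧ s ∘ f = p ∧ t ∘ f = q := by
  classical
  have heq : ∀ i j, p i = p j ↔ q i = q j := fun i j => by
    have h1 := h i j
    have h2 := h j i
    omega
  obtain ⟨N, hN⟩ : ∃ N, ∀ i, p i < N :=
    ⟨Finset.univ.sup p + 1, fun i => Nat.lt_succ_of_le (Finset.le_sup (Finset.mem_univ i))⟩
  obtain ⟨N', hN'⟩ : ∃ N', ∀ i, q i < N' :=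
    ⟨Finset.univ.sup q + 1, fun i => Nat.lt_succ_of_le (Finset.le_sup (Finset.mem_univ i))⟩
  let A := Finset.univ.image p
  have hA : A.card ≤ Fintype.card I := Finset.card_image_le
  -- If `p` is not injective its image is too small; padding above all values of `p` gives exactly
  -- `card I` elements.
  let T := A ∪ Finset.Ico N (N + (Fintype.card I - A.card))
  have hT : T.card = Fintype.card I := by
    rw [Finset.card_union_of_disjoint, Nat.card_Ico]
    · omega
    · rw [Finset.disjoint_left]
      intro m hm hm'
      obtain ⟨i, -, rfl⟩ := Finset.mem_image.1 hm
      exact absurd (Finset.mem_Ico.1 hm').1 (not_le.2 (hN i))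
  let s := T.orderEmbOfFin hT
  have hs : ∀ i, ∃ m, s m = p i := fun i => by
    have : p i ∈ Set.range s := by
      rw [Finset.range_orderEmbOfFin]
      exact Finset.mem_union_left _ (Finset.mem_image_of_mem p (Finset.mem_univ i))
    exact this
  choose f hf using hs
  have hbig : ∀ m, (¬ ∃ i, f i = m) → N ≤ s m := fun m hm => by
    rcases Finset.mem_union.1 (T.orderEmbOfFin_mem hT m) with h1 | h1
    · obtain ⟨i, -, hi⟩ := Finset.mem_image.1 h1
      exact absurd ⟨i, s.injective ((hf i).trans hi)⟩ hm
    · exact (Finset.mem_Ico.1 h1).1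
  -- Padded positions receive values beyond every `q i`, so `t` is increasing with the same index
  -- map `f`.
  let t : Fin (Fintype.card I) → ℕ := fun m => if h : ∃ i, f i = m then q h.choose else N' + m
  have ht : ∀ i, t (f i) = q i := fun i => by
    have hex : ∃ j, f j = f i := ⟨i, rfl⟩
    simp only [t, dif_pos hex]
    rw [← heq, ← hf, ← hf, hex.choose_spec]
  refine ⟨f, s, t, s.strictMono, fun m m' hmm => ?_, funext hf, funext ht⟩
  by_cases h1 : ∃ i, f i = m <;> by_cases h2 : ∃ i, f i = m'
  · obtain ⟨i, rfl⟩ := h1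
    obtain ⟨j, rfl⟩ := h2
    rw [ht, ht, ← h, ← hf, ← hf]
    exact s.strictMono hmm
  · obtain ⟨i, rfl⟩ := h1
    have : t m' = N' + m' := dif_neg h2
    rw [ht, this]
    have := hN' i
    omega
  · obtain ⟨j, rfl⟩ := h2
    have h3 := hbig m h1
    have h4 := s.strictMono hmm
    rw [hf] at h4
    have := hN j
    omega
  · have h3 : t m = N' + m := dif_neg h1
    have h4 : t m' = N' + m' := dif_neg h2
    rw [h3, h4]
    have : (m : ℕ) < m' := hmm
    omega

/-- Every finite colouring of the maps `I → ℕ` depends only on the order type of the map, after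
restriction to an infinite set. -/
theorem exists_strictMono_colour_eq {I κ : Type*} [Finite I] [Finite κ] (c : (I → ℕ) → κ) :
    ∃ h : ℕ → ℕ, StrictMono h ∧ ∀ p q : I → ℕ, (∀ i j, p i < p j ↔ q i < q j) →
      c (h ∘ p) = c (h ∘ q) := by
  classical
  have := Fintype.ofFinite I
  let r := Fintype.card I
  -- The colour of an `r`-set records the colours of all maps factoring through its increasing
  -- enumeration, so one homogeneous set serves every index map. The value at sets of other sizes is
  -- irrelevant.
  let d : Finset ℕ → (I → Fin r) → κ := fun s f =>
    if hs : s.card = r then c (s.orderEmbOfFin hs ∘ f) else c 0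
  obtain ⟨H, -, hH, k, hk⟩ := exists_infinite_homogeneous r Set.univ Set.infinite_univ d
  have : Infinite H := hH.to_subtype
  let h : ℕ ↪o ℕ := Nat.orderEmbeddingOfSet H
  have key : ∀ (t : Fin r → ℕ) (f : I → Fin r), StrictMono t → c (h ∘ t ∘ f) = k f := by
    intro t f ht
    have hmono : StrictMono (h ∘ t) := h.strictMono.comp ht
    let s : Finset ℕ := Finset.univ.image (h ∘ t)
    have hs : s.card = r := by
      rw [Finset.card_image_of_injective _ hmono.injective, Finset.card_univ, Fintype.card_fin]
    have h1 := hk s (by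
      intro m hm
      obtain ⟨i, -, rfl⟩ := Finset.mem_image.1 hm
      have : h (t i) ∈ Set.range h := Set.mem_range_self _
      rwa [Nat.orderEmbeddingOfSet_range] at this) hs
    have h2 : d s f = c (s.orderEmbOfFin hs ∘ f) := dif_pos hs
    have h3 : h ∘ t = s.orderEmbOfFin hs :=
      Finset.orderEmbOfFin_unique hs (fun i => Finset.mem_image_of_mem _ (Finset.mem_univ i)) hmono
    rw [← h1, h2, ← h3]
    rfl
  refine ⟨h, h.strictMono, fun p q hpq => ?_⟩
  obtain ⟨f, s, t, hs, ht, rfl, rfl⟩ := exists_strictMono_factorization p q hpq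
  rw [key s f hs, key t f ht]

/-- The finite form of `exists_strictMono_colour_eq`. -/
theorem exists_bound_strictMono_colour_eq (I κ : Type*) [Finite I] [Finite κ] (N : ℕ) :
    ∃ K : ℕ, ∀ c : (I → ℕ) → κ, ∃ h : ℕ → ℕ, StrictMono h ∧ (∀ i < N, h i < K) ∧
      ∀ p q : I → ℕ, (∀ i, p i < N) → (∀ i, q i < N) → (∀ i j, p i < p j ↔ q i < q j) →
        c (h ∘ p) = c (h ∘ q) := by
  by_contra! hcon
  choose c hc using hcon
  -- Compactness: the bad colourings `c K` have an ultralimit `d`. A good `h` for `d` is good for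
  -- some large `K`, since only the finitely many maps with values below `N` matter.
  let U : Ultrafilter ℕ := hyperfilter ℕ
  have hlim : ∀ p : I → ℕ, ∃ k : κ, ∀ᶠ K in (U : Filter ℕ), c K p = k := fun p => by
    obtain ⟨k, hk⟩ := Ultrafilter.eq_pure_of_finite (U.map fun K => c K p)
    have hmem : {k} ∈ U.map fun K => c K p := by rw [hk]; exact Set.mem_singleton k
    exact ⟨k, hmem⟩
  choose d hd using hlim
  obtain ⟨h, hmono, hh⟩ := exists_strictMono_colour_eq d
  have h1 : ∀ᶠ K in (U : Filter ℕ), ∀ p : I → Fin N,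
      c K (h ∘ fun i => (p i : ℕ)) = d (h ∘ fun i => (p i : ℕ)) :=
    eventually_all.2 fun p => hd _
  have h2 : ∀ᶠ K in (U : Filter ℕ), h N ≤ K :=
    Nat.hyperfilter_le_atTop (eventually_ge_atTop (h N))
  obtain ⟨K, hK1, hK2⟩ := (h1.and h2).exists
  obtain ⟨p, q, hp, hq, hpq, hne⟩ := hc K h hmono fun i hi => (hmono hi).trans_le hK2
  refine hne ?_
  have e1 := hK1 fun i => ⟨p i, hp i⟩
  have e2 := hK1 fun i => ⟨q i, hq i⟩
  exact e1.trans ((hh p q hpq).trans e2.symm)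

/-- Bounded families of real-valued functions on `I → ℕ` depend, up to a small error, only on the
order type, after restriction to a suitable finite set. -/
theorem exists_bound_strictMono_approx (I J : Type*) [Finite I] [Finite J] (N : ℕ) (C : ℝ) {ε : ℝ}
    (hε : 0 < ε) :
    ∃ K : ℕ, ∀ c : (I → ℕ) → J → ℝ, (∀ p j, |c p j| ≤ C) →
      ∃ h : ℕ → ℕ, StrictMono h ∧ (∀ i < N, h i < K) ∧
        ∀ p q : I → ℕ, (∀ i, p i < N) → (∀ i, q i < N) → (∀ i j, p i < p j ↔ q i < q j) →
          ∀ j, |c (h ∘ p) j - c (h ∘ q) j| ≤ ε := by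
  -- The colour of a value is its integer part in units of `ε`; boundedness by `C` leaves finitely
  -- many colours.
  obtain ⟨K, hK⟩ := exists_bound_strictMono_colour_eq I
    (J → Set.Icc ⌊-C / ε⌋ ⌊C / ε⌋) N
  refine ⟨K, fun c hc => ?_⟩
  let d : (I → ℕ) → J → Set.Icc ⌊-C / ε⌋ ⌊C / ε⌋ := fun p j =>
    ⟨⌊c p j / ε⌋, Int.floor_mono (by gcongr; exact (abs_le.1 (hc p j)).1),
      Int.floor_mono (by gcongr; exact (abs_le.1 (hc p j)).2)⟩
  obtain ⟨h, hmono, hlt, hh⟩ := hK d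
  refine ⟨h, hmono, hlt, fun p q hp hq hpq j => ?_⟩
  have h1 : ⌊c (h ∘ p) j / ε⌋ = ⌊c (h ∘ q) j / ε⌋ :=
    congrArg Subtype.val (congrFun (hh p q hp hq hpq) j)
  have h2 := Int.abs_sub_lt_one_of_floor_eq_floor h1
  rw [← sub_div, abs_div, abs_of_pos hε, div_lt_one hε] at h2
  exact h2.le

end Ramsey

/-! ### Partial isomorphisms between tuples in relational structures -/

section Tuples

variable {L : FirstOrder.Language.{u, v}} [L.IsRelational] {M : Type w} [L.Structure M]

/-- In a relational language every set is (the universe of) a substructure. -/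
def setSubstructure (L : FirstOrder.Language.{u, v}) [L.IsRelational] {M : Type w} [L.Structure M]
    (S : Set M) : L.Substructure M where
  carrier := S
  fun_mem f := isEmptyElim f

lemma setSubstructure_fg {S : Set M} (hS : S.Finite) : (setSubstructure L S).FG := by
  rw [Substructure.fg_iff_structure_fg, Structure.fg_iff_finite]
  exact hS.to_subtype

/-- Two injective tuples satisfying the same relations give a partial isomorphism. -/
noncomputable def tuplePartialEquiv {ι : Type*} (a b : ι → M) (ha : Function.Injective a)
    (hb : Function.Injective b)
    (h : ∀ (m : ℕ) (R : L.Relations m) (v : Fin m → ι),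
      Structure.RelMap R (a ∘ v) ↔ Structure.RelMap R (b ∘ v)) : M ≃ₚ[L] M where
  dom := setSubstructure L (Set.range a)
  cod := setSubstructure L (Set.range b)
  toEquiv :=
    { toEquiv := (Equiv.ofInjective a ha).symm.trans (Equiv.ofInjective b hb)
      map_fun' := fun f => isEmptyElim f
      map_rel' := fun {m} R y => by
        obtain ⟨v, rfl⟩ : ∃ v : Fin m → ι, y = fun i => Equiv.ofInjective a ha (v i) :=
          ⟨fun i => (Equiv.ofInjective a ha).symm (y i),
            funext fun i => ((Equiv.ofInjective a ha).apply_symm_apply (y i)).symm⟩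
        refine Iff.trans ?_ ((h m R v).symm.trans ?_)
        · change Structure.RelMap R (fun i => (Equiv.ofInjective b hb
            ((Equiv.ofInjective a ha).symm (Equiv.ofInjective a ha (v i))) : M)) ↔ _
          simp only [Equiv.symm_apply_apply]
          rfl
        · rfl }

lemma tuplePartialEquiv_apply {ι : Type*} (a b : ι → M) (ha : Function.Injective a)
    (hb : Function.Injective b)
    (h : ∀ (m : ℕ) (R : L.Relations m) (v : Fin m → ι),
      Structure.RelMap R (a ∘ v) ↔ Structure.RelMap R (b ∘ v)) (i : ι)
    (hi : a i ∈ (tuplePartialEquiv a b ha hb h).dom) :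
    ((tuplePartialEquiv a b ha hb h).toEquiv ⟨a i, hi⟩ : M) = b i := by
  change ((Equiv.ofInjective b hb ((Equiv.ofInjective a ha).symm ⟨a i, hi⟩) : _) : M) = b i
  have : (Equiv.ofInjective a ha).symm ⟨a i, hi⟩ = i := Equiv.ofInjective_symm_apply ha i
  rw [this]
  rfl

/-- In an ultrahomogeneous relational structure two finite injective tuples satisfying the same
relations are conjugate. -/
theorem exists_aut_of_relMap_iff (hu : L.IsUltrahomogeneous M) {ι : Type*} [Finite ι] (a b : ι → M)
    (ha : Function.Injective a) (hb : Function.Injective b)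
    (h : ∀ (m : ℕ) (R : L.Relations m) (v : Fin m → ι),
      Structure.RelMap R (a ∘ v) ↔ Structure.RelMap R (b ∘ v)) :
    ∃ g : Aut L M, ∀ i, g (a i) = b i := by
  let f := tuplePartialEquiv a b ha hb h
  obtain ⟨g, hg⟩ := hu f.dom (setSubstructure_fg (Set.finite_range a)) f.toEmbedding
  refine ⟨g, fun i => ?_⟩
  have hi : a i ∈ f.dom := Set.mem_range_self i
  have h1 := DFunLike.congr_fun hg ⟨a i, hi⟩
  rw [PartialEquiv.toEmbedding_apply, tuplePartialEquiv_apply] at h1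
  exact h1.symm

end Tuples

/-! ### Labelled sets as structures -/

section Labelled

variable {P : Set ℕ}

/-- A set whose subsets carry labels, viewed as a `langP P`-structure: sets of the same size are
equivalent if they have the same label, and they are compared according to their labels. -/
def Labelled {V : Type w} (_lab : Set V → ℕ) : Type w := V

/-- The interpretation of the relation symbols in a labelled set. -/
def labelledRel {V : Type w} (lab : Set V → ℕ) : ∀ {m : ℕ}, Rel P m → (Fin m → V) → Prop
  | _, .E n _, z => Function.Injective (z ∘ Fin.castAdd n) ∧ Function.Injective (z ∘ Fin.natAdd n) ∧
      lab (Set.range (z ∘ Fin.castAdd n)) = lab (Set.range (z ∘ Fin.natAdd n))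
  | _, .lt n _, z => Function.Injective (z ∘ Fin.castAdd n) ∧
      Function.Injective (z ∘ Fin.natAdd n) ∧
      lab (Set.range (z ∘ Fin.castAdd n)) < lab (Set.range (z ∘ Fin.natAdd n))

instance {V : Type w} (lab : Set V → ℕ) : (langP P).Structure (Labelled lab) where
  funMap f := f.elim
  RelMap r z := labelledRel (V := V) lab r z

lemma append_comp_castAdd {α : Type*} {m n : ℕ} (s : Fin m → α) (t : Fin n → α) :
    Fin.append s t ∘ Fin.castAdd n = s := by
  funext i
  simp

lemma append_comp_natAdd {α : Type*} {m n : ℕ} (s : Fin m → α) (t : Fin n → α) :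
    Fin.append s t ∘ Fin.natAdd m = t := by
  funext i
  simp

lemma relE_labelled {V : Type w} (lab : Set V → ℕ) (n : ℕ) (hn : 0 < n) (s t : Fin n → V) :
    relE P (C := Labelled lab) n hn s t ↔
      Function.Injective s ∧ Function.Injective t ∧ lab (Set.range s) = lab (Set.range t) := by
  change labelledRel lab (Rel.E n hn : Rel P _) (Fin.append s t) ↔ _
  rw [labelledRel, append_comp_castAdd, append_comp_natAdd]

lemma relLt_labelled {V : Type w} (lab : Set V → ℕ) (n : ℕ) (hn : n ∈ P) (s t : Fin n → V) :
    relLt P (C := Labelled lab) n hn s t ↔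
      Function.Injective s ∧ Function.Injective t ∧ lab (Set.range s) < lab (Set.range t) := by
  change labelledRel lab (Rel.lt n hn : Rel P _) (Fin.append s t) ↔ _
  rw [labelledRel, append_comp_castAdd, append_comp_natAdd]

lemma labelled_mem_classK (hP : ∀ n ∈ P, 3 ≤ n) {V : Type w} [Finite V] (lab : Set V → ℕ) :
    (⟨Labelled lab, inferInstance⟩ : CategoryTheory.Bundled.{w} (langP P).Structure) ∈
      classK P hP := by
  refine ⟨‹Finite V›, fun n hn => ⟨?_, ?_, ?_, ?_⟩, fun n hn => ⟨?_, ?_, ?_, ?_, ?_⟩⟩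
  · exact fun s t h => ⟨((relE_labelled lab n hn s t).1 h).1, ((relE_labelled lab n hn s t).1 h).2.1⟩
  · exact fun s hs σ => (relE_labelled lab n hn s _).2 ⟨hs, hs.comp σ.injective,
      congrArg lab (σ.surjective.range_comp s).symm⟩
  · intro s t h
    have h := (relE_labelled lab n hn s t).1 h
    exact (relE_labelled lab n hn t s).2 ⟨h.2.1, h.1, h.2.2.symm⟩
  · intro s t r h h'
    have h := (relE_labelled lab n hn s t).1 h
    have h' := (relE_labelled lab n hn t r).1 h'
    exact (relE_labelled lab n hn s r).2 ⟨h.1, h'.2.1, h.2.2.trans h'.2.2⟩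
  · exact fun s t h =>
      ⟨((relLt_labelled lab n hn s t).1 h).1, ((relLt_labelled lab n hn s t).1 h).2.1⟩
  · intro s t p q h1 h2 h3
    have h1 := (relE_labelled lab n _ s t).1 h1
    have h2 := (relE_labelled lab n _ p q).1 h2
    have h3 := (relLt_labelled lab n hn s p).1 h3
    exact (relLt_labelled lab n hn t q).2 ⟨h1.2.1, h2.2.1, h1.2.2 ▸ h2.2.2 ▸ h3.2.2⟩
  · intro s t h1 h2
    exact absurd ((relE_labelled lab n _ s t).1 h2).2.2
      ((relLt_labelled lab n hn s t).1 h1).2.2.ne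
  · intro s t r h h'
    have h := (relLt_labelled lab n hn s t).1 h
    have h' := (relLt_labelled lab n hn t r).1 h'
    exact (relLt_labelled lab n hn s r).2 ⟨h.1, h'.2.1, h.2.2.trans h'.2.2⟩
  · intro s t hs ht h
    have h := fun h3 => h ((relE_labelled lab n _ s t).2 ⟨hs, ht, h3⟩)
    rcases lt_or_gt_of_ne h with h | h
    · exact Or.inl ((relLt_labelled lab n hn s t).2 ⟨hs, ht, h⟩)
    · exact Or.inr ((relLt_labelled lab n hn t s).2 ⟨ht, hs, h⟩)

end Labelled

/-! ### Basic properties of the generic structure -/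

section Generic

variable {P : Set ℕ} {hP : ∀ n ∈ P, 3 ≤ n}

lemma append_comp_apply {α β : Type*} {m n : ℕ} (f : α → β) (s : Fin m → α) (t : Fin n → α) :
    Fin.append (f ∘ s) (f ∘ t) = f ∘ Fin.append s t := by
  funext i
  refine Fin.addCases (fun i => ?_) (fun i => ?_) i <;> simp

lemma relE_embedding {C : Type w} {D : Type x} [(langP P).Structure C] [(langP P).Structure D]
    (f : C ↪[langP P] D) (n : ℕ) (hn : 0 < n) (s t : Fin n → C) :
    relE P n hn (f ∘ s) (f ∘ t) ↔ relE P n hn s t := by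
  rw [relE, append_comp_apply]
  exact f.map_rel _ _

lemma relLt_embedding {C : Type w} {D : Type x} [(langP P).Structure C] [(langP P).Structure D]
    (f : C ↪[langP P] D) (n : ℕ) (hn : n ∈ P) (s t : Fin n → C) :
    relLt P n hn (f ∘ s) (f ∘ t) ↔ relLt P n hn s t := by
  rw [relLt, append_comp_apply]
  exact f.map_rel _ _

lemma relMap_comp_iff {M : Type w} {N : Type x} [(langP P).Structure M] [(langP P).Structure N]
    {ι : Type*} {a : ι → M} {b : ι → N}
    (hE : ∀ (n : ℕ) (hn : 0 < n) (s t : Fin n → ι),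
      relE P n hn (a ∘ s) (a ∘ t) ↔ relE P n hn (b ∘ s) (b ∘ t))
    (hlt : ∀ (n : ℕ) (hn : n ∈ P) (s t : Fin n → ι),
      relLt P n hn (a ∘ s) (a ∘ t) ↔ relLt P n hn (b ∘ s) (b ∘ t))
    (m : ℕ) (R : (langP P).Relations m) (z : Fin m → ι) :
    Structure.RelMap R (a ∘ z) ↔ Structure.RelMap R (b ∘ z) := by
  have key : ∀ (n : ℕ) (z : Fin (n + n) → ι),
      z = Fin.append (z ∘ Fin.castAdd n) (z ∘ Fin.natAdd n) := fun n z =>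
    funext fun i => Fin.addCases
      (fun i => (Fin.append_left (z ∘ Fin.castAdd n) (z ∘ Fin.natAdd n) i).symm)
      (fun i => (Fin.append_right (z ∘ Fin.castAdd n) (z ∘ Fin.natAdd n) i).symm) i
  cases R with
  | E n hn =>
    rw [key n z, ← append_comp_apply, ← append_comp_apply]
    exact hE n hn _ _
  | lt n hn =>
    rw [key n z, ← append_comp_apply, ← append_comp_apply]
    exact hlt n hn _ _

lemma exists_lift_setSubstructure {M : Type w} [(langP P).Structure M] {n : ℕ} {T : Set M}
    (s : Fin n → M) (hs : Set.range s ⊆ T) :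
    ∃ s' : Fin n → setSubstructure (langP P) T,
      (setSubstructure (langP P) T).subtype ∘ s' = s :=
  ⟨fun i => ⟨s i, hs (Set.mem_range_self i)⟩, rfl⟩

variable {M : Type w} [Countable M] [(langP P).Structure M]

lemma setSubstructure_mem_classK (hM : IsFraisseLimit (classK.{w} P hP) M) {T : Set M}
    (hT : T.Finite) :
    (⟨setSubstructure (langP P) T, inferInstance⟩ :
      CategoryTheory.Bundled.{w} (langP P).Structure) ∈ classK P hP := by
  rw [← hM.age]
  exact age.fg_substructure (setSubstructure_fg hT)

/-- Each axiom concerns at most three tuples at once, so it can be checked in a finite substructure,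
which lies in the age. -/
theorem isEquivOnSubsets_of_isFraisseLimit (hM : IsFraisseLimit (classK.{w} P hP) M) (n : ℕ)
    (hn : 0 < n) : IsEquivOnSubsets (relE P (C := M) n hn) := by
  have key : ∀ s t r : Fin n → M, ∃ (T : Set M) (s' t' r' : Fin n → setSubstructure (langP P) T),
      (setSubstructure (langP P) T).subtype ∘ s' = s ∧
      (setSubstructure (langP P) T).subtype ∘ t' = t ∧
      (setSubstructure (langP P) T).subtype ∘ r' = r ∧
      IsEquivOnSubsets (relE P (C := setSubstructure (langP P) T) n hn) := by
    intro s t r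
    let T := Set.range s ∪ Set.range t ∪ Set.range r
    have hT : T.Finite :=
      ((Set.finite_range s).union (Set.finite_range t)).union (Set.finite_range r)
    obtain ⟨s', hs⟩ := exists_lift_setSubstructure (P := P) (T := T) s
      (Set.subset_union_left.trans Set.subset_union_left)
    obtain ⟨t', ht⟩ := exists_lift_setSubstructure (P := P) (T := T) t
      (Set.subset_union_right.trans Set.subset_union_left)
    obtain ⟨r', hr⟩ := exists_lift_setSubstructure (P := P) (T := T) r Set.subset_union_right
    exact ⟨T, s', t', r', hs, ht, hr, (setSubstructure_mem_classK hM hT).2.1 n hn⟩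
  refine ⟨fun s t => ?_, fun s => ?_, fun s t => ?_, fun s t r => ?_⟩
  · obtain ⟨T, s', t', -, rfl, rfl, -, h⟩ := key s t t
    rw [relE_embedding]
    exact fun h' => ⟨Subtype.val_injective.comp (h.inj _ _ h').1,
      Subtype.val_injective.comp (h.inj _ _ h').2⟩
  · obtain ⟨T, s', -, -, rfl, -, -, h⟩ := key s s s
    intro hs σ
    rw [Function.comp_assoc, relE_embedding]
    exact h.perm _ hs.of_comp σ
  · obtain ⟨T, s', t', -, rfl, rfl, -, h⟩ := key s t t
    rw [relE_embedding, relE_embedding]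
    exact h.symm _ _
  · obtain ⟨T, s', t', r', rfl, rfl, rfl, h⟩ := key s t r
    rw [relE_embedding, relE_embedding, relE_embedding]
    exact h.trans _ _ _

theorem isLinearOrderOnClasses_of_isFraisseLimit (hM : IsFraisseLimit (classK.{w} P hP) M) (n : ℕ)
    (hn : n ∈ P) (hn' : 0 < n) :
    IsLinearOrderOnClasses (relE P (C := M) n hn') (relLt P (C := M) n hn) := by
  have key : ∀ s t p q : Fin n → M,
      ∃ (T : Set M) (s' t' p' q' : Fin n → setSubstructure (langP P) T),
      (setSubstructure (langP P) T).subtype ∘ s' = s ∧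
      (setSubstructure (langP P) T).subtype ∘ t' = t ∧
      (setSubstructure (langP P) T).subtype ∘ p' = p ∧
      (setSubstructure (langP P) T).subtype ∘ q' = q ∧
      IsLinearOrderOnClasses (relE P (C := setSubstructure (langP P) T) n hn')
        (relLt P (C := setSubstructure (langP P) T) n hn) := by
    intro s t p q
    let T := (Set.range s ∪ Set.range t) ∪ (Set.range p ∪ Set.range q)
    have hT : T.Finite := ((Set.finite_range s).union (Set.finite_range t)).union
      ((Set.finite_range p).union (Set.finite_range q))
    obtain ⟨s', hs⟩ := exists_lift_setSubstructure (P := P) (T := T) s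
      (Set.subset_union_left.trans Set.subset_union_left)
    obtain ⟨t', ht⟩ := exists_lift_setSubstructure (P := P) (T := T) t
      (Set.subset_union_right.trans Set.subset_union_left)
    obtain ⟨p', hp⟩ := exists_lift_setSubstructure (P := P) (T := T) p
      (Set.subset_union_left.trans Set.subset_union_right)
    obtain ⟨q', hq⟩ := exists_lift_setSubstructure (P := P) (T := T) q
      (Set.subset_union_right.trans Set.subset_union_right)
    exact ⟨T, s', t', p', q', hs, ht, hp, hq, (setSubstructure_mem_classK hM hT).2.2 n hn⟩
  refine ⟨fun s t => ?_, fun s t p q => ?_, fun s t => ?_, fun s t r => ?_, fun s t => ?_⟩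
  · obtain ⟨T, s', t', -, -, rfl, rfl, -, -, h⟩ := key s t t t
    rw [relLt_embedding]
    exact fun h' => ⟨Subtype.val_injective.comp (h.inj _ _ h').1,
      Subtype.val_injective.comp (h.inj _ _ h').2⟩
  · obtain ⟨T, s', t', p', q', rfl, rfl, rfl, rfl, h⟩ := key s t p q
    rw [relLt_embedding, relLt_embedding, relE_embedding, relE_embedding]
    exact h.respects _ _ _ _
  · obtain ⟨T, s', t', -, -, rfl, rfl, -, -, h⟩ := key s t t t
    rw [relLt_embedding, relE_embedding]
    exact h.irrefl _ _
  · obtain ⟨T, s', t', r', -, rfl, rfl, rfl, -, h⟩ := key s t r r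
    rw [relLt_embedding, relLt_embedding, relLt_embedding]
    exact h.trans _ _ _
  · obtain ⟨T, s', t', -, -, rfl, rfl, -, -, h⟩ := key s t t t
    rw [relLt_embedding, relE_embedding, relLt_embedding]
    exact fun hs ht => h.total _ _ hs.of_comp ht.of_comp

/-- Every finite labelled set embeds into the generic structure. -/
theorem exists_labelled_embedding (hM : IsFraisseLimit (classK.{w} P hP) M) {V : Type*} [Finite V]
    (lab : Set V → ℕ) :
    ∃ e : V → M, Function.Injective e ∧
      (∀ (n : ℕ) (hn : 0 < n) (s t : Fin n → V), relE P n hn (e ∘ s) (e ∘ t) ↔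
        Function.Injective s ∧ Function.Injective t ∧ lab (Set.range s) = lab (Set.range t)) ∧
      ∀ (n : ℕ) (hn : n ∈ P) (s t : Fin n → V), relLt P n hn (e ∘ s) (e ∘ t) ↔
        Function.Injective s ∧ Function.Injective t ∧ lab (Set.range s) < lab (Set.range t) := by
  obtain ⟨k, ⟨f⟩⟩ := Finite.exists_equiv_fin V
  let j : V ≃ ULift.{w} (Fin k) := f.trans Equiv.ulift.symm
  let lab' : Set (ULift.{w} (Fin k)) → ℕ := fun S => lab (j ⁻¹' S)
  have hmem := labelled_mem_classK hP lab'
  rw [← hM.age] at hmem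
  obtain ⟨-, ⟨e⟩⟩ := hmem
  have hlab : ∀ (n : ℕ) (s : Fin n → V), lab' (Set.range (j ∘ s)) = lab (Set.range s) := by
    intro n s
    simp only [lab', Set.range_comp]
    rw [Set.preimage_image_eq _ j.injective]
  refine ⟨fun p => e (j p), e.injective.comp j.injective, fun n hn s t => ?_, fun n hn s t => ?_⟩
  · have h : (Function.Injective (j ∘ s) ∧ Function.Injective (j ∘ t) ∧
        lab' (Set.range (j ∘ s)) = lab' (Set.range (j ∘ t))) ↔ Function.Injective s ∧
        Function.Injective t ∧ lab (Set.range s) = lab (Set.range t) := by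
      rw [hlab, hlab, j.injective.of_comp_iff, j.injective.of_comp_iff]
    exact (relE_embedding e n hn (j ∘ s) (j ∘ t)).trans ((relE_labelled lab' n hn _ _).trans h)
  · have h : (Function.Injective (j ∘ s) ∧ Function.Injective (j ∘ t) ∧
        lab' (Set.range (j ∘ s)) < lab' (Set.range (j ∘ t))) ↔ Function.Injective s ∧
        Function.Injective t ∧ lab (Set.range s) < lab (Set.range t) := by
      rw [hlab, hlab, j.injective.of_comp_iff, j.injective.of_comp_iff]
    exact (relLt_embedding e n hn (j ∘ s) (j ∘ t)).trans ((relLt_labelled lab' n hn _ _).trans h)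

end Generic

/-! ### Failure of Hrushovski's extension property -/

section Hrushovski

variable {P : Set ℕ} {hP : ∀ n ∈ P, 3 ≤ n} {M : Type w} [Countable M] [(langP P).Structure M]

lemma not_relLt_self (hM : IsFraisseLimit (classK.{w} P hP) M) {n : ℕ} (hn : n ∈ P)
    (s : Fin n → M) : ¬ relLt P n hn s s := fun h => by
  have hn' : 0 < n := Nat.lt_of_lt_of_le (by decide) (hP n hn)
  have hlo := isLinearOrderOnClasses_of_isFraisseLimit hM n hn hn'
  exact hlo.irrefl s s h ((isEquivOnSubsets_of_isFraisseLimit hM n hn').perm s (hlo.inj s s h).1 1)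

/-- An automorphism of a finite substructure cannot move a tuple upwards. -/
lemma not_relLt_comp_of_finite (hM : IsFraisseLimit (classK.{w} P hP) M) {n : ℕ} (hn : n ∈ P)
    (F : (langP P).Substructure M) [Finite F] (g : F ≃[langP P] F) (s : Fin n → F) :
    ¬ relLt P n hn s (g ∘ s) := fun h => by
  have hn' : 0 < n := Nat.lt_of_lt_of_le (by decide) (hP n hn)
  have hlo := isLinearOrderOnClasses_of_isFraisseLimit hM n hn hn'
  let π : Equiv.Perm F := g.toEquiv
  have hstep : ∀ i : ℕ, relLt P n hn ((π ^ i) ∘ s) ((π ^ (i + 1)) ∘ s) := by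
    intro i
    induction i with
    | zero => exact h
    | succ i ih =>
      have := (relLt_embedding g.toEmbedding n hn _ _).2 ih
      rw [pow_succ' π (i + 1)]
      rw [pow_succ' π i] at this ⊢
      exact this
  have hchain : ∀ i : ℕ, relLt P n hn (F.subtype ∘ s) (F.subtype ∘ (π ^ (i + 1)) ∘ s) := by
    intro i
    induction i with
    | zero => exact (relLt_embedding F.subtype n hn _ _).2 (hstep 0)
    | succ i ih => exact hlo.trans _ _ _ ih ((relLt_embedding F.subtype n hn _ _).2 (hstep (i + 1)))
  obtain ⟨k, hk, hk'⟩ := (isOfFinOrder_of_finite π).exists_pow_eq_one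
  obtain ⟨i, rfl⟩ := Nat.exists_eq_add_of_lt hk
  have := hchain i
  rw [zero_add] at hk'
  rw [hk'] at this
  exact not_relLt_self hM hn _ this

/-- Two disjoint `n`-sets are chosen so that each, taken alone, carries the trivial structure, while
the first lies strictly `<_n`-below the second. Any automorphism of a finite substructure extending
the isomorphism between them would generate an increasing chain that closes up. -/
theorem not_hrushovskiExtension (hne : P.Nonempty) (hM : IsFraisseLimit (classK.{w} P hP) M) :
    ¬ HrushovskiExtension (langP P) M := by
  classical
  intro hH
  obtain ⟨n, hn⟩ := hne
  have hn' : 0 < n := Nat.lt_of_lt_of_le (by decide) (hP n hn)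
  -- Only the full left copy has label `0`. Within either copy all sets of the same size have equal
  -- labels, so the copies are isomorphic.
  let lab : Set (Fin n ⊕ Fin n) → ℕ := fun S => if S = Set.range Sum.inl then 0 else 1
  obtain ⟨e, he, heE, helt⟩ := exists_labelled_embedding hM lab
  have hinr : ∀ (m : ℕ) (s : Fin m → Fin n), 0 < m → lab (Set.range (Sum.inr ∘ s)) = 1 := by
    intro m s hm
    refine if_neg fun h => ?_
    have : (Sum.inr ∘ s) ⟨0, hm⟩ ∈ Set.range (Sum.inl : Fin n → Fin n ⊕ Fin n) :=
      h ▸ Set.mem_range_self _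
    obtain ⟨i, hi⟩ := this
    cases hi
  have hinl : ∀ (m : ℕ) (s t : Fin m → Fin n), Function.Injective s → Function.Injective t →
      lab (Set.range (Sum.inl ∘ s)) = lab (Set.range (Sum.inl ∘ t)) := by
    have key : ∀ (m : ℕ) (s : Fin m → Fin n), Function.Injective s →
        (Set.range (Sum.inl ∘ s) = Set.range (Sum.inl : Fin n → Fin n ⊕ Fin n) ↔ m = n) := by
      intro m s hs
      rw [Set.range_comp, ← Set.image_univ (f := (Sum.inl : Fin n → Fin n ⊕ Fin n)),
        Sum.inl_injective.image_injective.eq_iff,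
        Set.range_eq_univ]
      constructor
      · intro h
        simpa using Fintype.card_of_bijective ⟨hs, h⟩
      · rintro rfl
        exact Finite.surjective_of_injective hs
    intro m s t hs ht
    simp only [lab, key m s hs, key m t ht]
  have hEiff : ∀ (m : ℕ) (hm : 0 < m) (s t : Fin m → Fin n),
      relE P m hm ((e ∘ Sum.inl) ∘ s) ((e ∘ Sum.inl) ∘ t) ↔
        relE P m hm ((e ∘ Sum.inr) ∘ s) ((e ∘ Sum.inr) ∘ t) := by
    intro m hm s t
    rw [Function.comp_assoc, Function.comp_assoc, Function.comp_assoc, Function.comp_assoc, heE, heE,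
      Sum.inl_injective.of_comp_iff, Sum.inl_injective.of_comp_iff, Sum.inr_injective.of_comp_iff,
      Sum.inr_injective.of_comp_iff, hinr m s hm, hinr m t hm]
    exact ⟨fun h => ⟨h.1, h.2.1, rfl⟩, fun h => ⟨h.1, h.2.1, hinl m s t h.1 h.2.1⟩⟩
  have hltiff : ∀ (m : ℕ) (hm : m ∈ P) (s t : Fin m → Fin n),
      relLt P m hm ((e ∘ Sum.inl) ∘ s) ((e ∘ Sum.inl) ∘ t) ↔
        relLt P m hm ((e ∘ Sum.inr) ∘ s) ((e ∘ Sum.inr) ∘ t) := by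
    intro m hm s t
    have hm' : 0 < m := Nat.lt_of_lt_of_le (by decide) (hP m hm)
    rw [Function.comp_assoc, Function.comp_assoc, Function.comp_assoc, Function.comp_assoc, helt,
      helt, Sum.inl_injective.of_comp_iff, Sum.inl_injective.of_comp_iff,
      Sum.inr_injective.of_comp_iff, Sum.inr_injective.of_comp_iff, hinr m s hm', hinr m t hm']
    exact ⟨fun h => absurd (hinl m s t h.1 h.2.1) h.2.2.ne, fun h => absurd rfl h.2.2.ne⟩
  let f : M ≃ₚ[langP P] M := tuplePartialEquiv (e ∘ Sum.inl) (e ∘ Sum.inr)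
    (he.comp Sum.inl_injective) (he.comp Sum.inr_injective) (relMap_comp_iff hEiff hltiff)
  obtain ⟨F, hF, hf⟩ := hH 1 (fun _ => f) fun _ =>
    (Set.finite_range (e ∘ (Sum.inl : Fin n → Fin n ⊕ Fin n))).to_subtype
  obtain ⟨hdom, -, g, hg⟩ := hf 0
  let s : Fin n → F := fun i => ⟨e (Sum.inl i), hdom (Set.mem_range_self i)⟩
  refine not_relLt_comp_of_finite hM hn F g s ?_
  rw [← relLt_embedding F.subtype]
  have h1 : F.subtype ∘ s = e ∘ Sum.inl := rfl
  have h2 : F.subtype ∘ g ∘ s = e ∘ Sum.inr := by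
    funext i
    have hi : e (Sum.inl i) ∈ f.dom := Set.mem_range_self i
    exact (hg (s i) hi).trans (tuplePartialEquiv_apply _ _ _ _ _ i hi)
  rw [h1, h2, helt]
  refine ⟨Sum.inl_injective, Sum.inr_injective, ?_⟩
  have h3 := hinr n id hn'
  rw [Function.comp_id] at h3
  rw [h3, show lab (Set.range Sum.inl) = 0 from if_pos rfl]
  exact Nat.zero_lt_one

end Hrushovski

/-! ### Extremely amenable groups and invariant equivalence relations -/

section Tournament

/-- The tournaments on the classes of an equivalence relation. -/
def tournaments {Q : Type x} (E : Setoid Q) : Set (Q → Q → Bool) :=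
  {R | (∀ p p' q q', E p p' → E q q' → R p q = R p' q') ∧ ∀ p q, ¬ E p q → R p q = !R q p}

lemma isClosed_tournaments {Q : Type x} (E : Setoid Q) : IsClosed (tournaments E) := by
  have hev : ∀ p q : Q, Continuous fun R : Q → Q → Bool => R p q := fun p q => by fun_prop
  refine IsClosed.and ?_ ?_
  · simp only [Set.ofPred_forall]
    exact isClosed_iInter fun p => isClosed_iInter fun p' => isClosed_iInter fun q =>
      isClosed_iInter fun q' => isClosed_iInter fun _ => isClosed_iInter fun _ =>
        isClosed_eq (hev p q) (hev p' q')
  · simp only [Set.ofPred_forall]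
    exact isClosed_iInter fun p => isClosed_iInter fun q => isClosed_iInter fun _ =>
      isClosed_eq (hev p q) ((continuous_of_discreteTopology (f := Bool.not)).comp (hev q p))

lemma tournaments_nonempty {Q : Type x} (E : Setoid Q) : (tournaments E).Nonempty := by
  classical
  let _ : LinearOrder (Quotient E) := linearOrderOfSTO WellOrderingRel
  refine ⟨fun p q => decide (Quotient.mk E p < Quotient.mk E q), fun p p' q q' hp hq => ?_,
    fun p q hpq => ?_⟩
  · simp only [Quotient.sound hp, Quotient.sound hq]
  · have : Quotient.mk E p ≠ Quotient.mk E q := fun h => hpq (Quotient.exact h)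
    rcases lt_or_gt_of_ne this with h | h
    · simp [h, h.le]
    · simp [h, h.le]

/-- The tournaments on the classes form a compact flow, so some tournament is invariant. If `g`
interchanged the classes of `p` and `g • p`, it would reverse the arrow between them. -/
lemma equiv_smul_of_equiv_smul_smul_aux {G : Type w} [Group G] [TopologicalSpace G]
    (hG : IsExtremelyAmenable.{w, x} G) {Q : Type x} [MulAction G Q]
    (hopen : ∀ p q : Q, IsOpen {g : G | g • p = q}) (E : Setoid Q)
    (hE : ∀ (g : G) (p q : Q), E p q → E (g • p) (g • q)) (g : G) (p : Q)
    (h : E (g • g • p) p) : E (g • p) p := by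
  have : CompactSpace (tournaments E) := isCompact_iff_compactSpace.1 (isClosed_tournaments E).isCompact
  have : Nonempty (tournaments E) := (tournaments_nonempty E).to_subtype
  let _ : MulAction G (tournaments E) :=
    { smul := fun g R => ⟨fun p q => R.1 (g⁻¹ • p) (g⁻¹ • q),
        fun p p' q q' hp hq => R.2.1 _ _ _ _ (hE _ _ _ hp) (hE _ _ _ hq),
        fun p q hpq => R.2.2 _ _ fun h => hpq (by simpa using hE g _ _ h)⟩
      one_smul := fun R => Subtype.ext (funext₂ fun p q => by
        change R.1 ((1 : G)⁻¹ • p) ((1 : G)⁻¹ • q) = R.1 p q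
        simp)
      mul_smul := fun g g' R => Subtype.ext (funext₂ fun p q => by
        change R.1 ((g * g')⁻¹ • p) ((g * g')⁻¹ • q) = R.1 (g'⁻¹ • g⁻¹ • p) (g'⁻¹ • g⁻¹ • q)
        simp [mul_smul]) }
  have hsmul : ∀ (g : G) (R : tournaments E) (p q : Q), (g • R).1 p q = R.1 (g⁻¹ • p) (g⁻¹ • q) :=
    fun _ _ _ _ => rfl
  have : ContinuousSMul G (tournaments E) := by
    refine ⟨Continuous.subtype_mk (continuous_pi fun p => continuous_pi fun q => ?_) _⟩
    refine continuous_iff_continuousAt.2 fun ⟨g₀, R₀⟩ => ?_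
    have hc : ContinuousAt (fun z : G × tournaments E => z.2.1 (g₀⁻¹ • p) (g₀⁻¹ • q)) (g₀, R₀) :=
      ((continuous_apply _).comp ((continuous_apply _).comp
        (continuous_subtype_val.comp continuous_snd))).continuousAt
    refine hc.congr ?_
    have hnear : ∀ p : Q, ∀ᶠ z : G × tournaments E in nhds (g₀, R₀), z.1⁻¹ • p = g₀⁻¹ • p := by
      intro p
      have h1 : ∀ᶠ g in nhds g₀, g • (g₀⁻¹ • p) = p := (hopen _ _).mem_nhds (smul_inv_smul g₀ p)
      filter_upwards [continuous_fst.continuousAt.eventually h1] with z hz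
      rw [inv_smul_eq_iff]
      exact hz.symm
    filter_upwards [hnear p, hnear q] with z hp hq
    rw [← hp, ← hq]
  obtain ⟨R, hR⟩ := hG (tournaments E)
  by_contra hne
  have h1 : R.1 (g • g • p) (g • p) = R.1 (g • p) p := by
    have := hsmul g R (g • g • p) (g • p)
    rwa [hR g, inv_smul_smul, inv_smul_smul] at this
  have h2 : R.1 (g • g • p) (g • p) = R.1 p (g • p) := R.2.1 _ _ _ _ h (E.refl _)
  have h3 := R.2.2 _ _ hne
  rw [← h1, h2] at h3
  have h4 := R.2.2 p (g • p) fun h => hne (E.symm h)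
  rw [← h1, h2] at h4
  simp at h4

/-- An element of an extremely amenable group acting on a countable set with an invariant
equivalence relation cannot interchange two classes. -/
theorem equiv_smul_of_equiv_smul_smul {G : Type w} [Group G] [TopologicalSpace G]
    (hG : IsExtremelyAmenable.{w, x} G) {Q : Type*} [Countable Q] [MulAction G Q]
    (hopen : ∀ p q : Q, IsOpen {g : G | g • p = q}) (E : Setoid Q)
    (hE : ∀ (g : G) (p q : Q), E p q → E (g • p) (g • q)) (g : G) (p : Q)
    (h : E (g • g • p) p) : E (g • p) p := by
  -- Extreme amenability is only assumed for flows in one universe; a countable set has a copy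
  -- there.
  let j : Shrink.{x} Q ≃ Q := (equivShrink.{x} Q).symm
  let _ : MulAction G (Shrink.{x} Q) := j.mulAction G
  have hj : ∀ (g : G) (q : Shrink.{x} Q), j (g • q) = g • j q := fun g q => by
    change j (j.symm (g • j q)) = _
    simp
  have := equiv_smul_of_equiv_smul_smul_aux hG (Q := Shrink.{x} Q) (fun q q' => ?_) (E.comap j)
    (fun g q q' hq => ?_) g (j.symm p) ?_
  · have : E (j (g • j.symm p)) (j (j.symm p)) := this
    rwa [hj, j.apply_symm_apply] at this
  · convert! hopen (j q) (j q') using 3 with g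
    rw [← hj, j.apply_eq_iff_eq]
  · change E (j _) (j _)
    rw [hj, hj]
    exact hE g _ _ hq
  · change E (j _) (j _)
    rw [hj, hj, j.apply_symm_apply]
    exact h

instance autMulAction (L : FirstOrder.Language.{u, v}) (M : Type w) [L.Structure M] :
    MulAction (Aut L M) M where
  smul g p := g p
  one_smul _ := rfl
  mul_smul _ _ _ := rfl

lemma isOpen_setOf_smul_eq {L : FirstOrder.Language.{u, v}} {M : Type w} [L.Structure M] (p q : M) :
    IsOpen {g : Aut L M | g • p = q} :=
  TopologicalSpace.isOpen_generateFrom_of_mem ⟨p, q, rfl⟩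

lemma isOpen_setOf_smul_tuple_eq {L : FirstOrder.Language.{u, v}} {M : Type w} [L.Structure M]
    {n : ℕ} (s t : Fin n → M) : IsOpen {g : Aut L M | g • s = t} := by
  have : {g : Aut L M | g • s = t} = ⋂ i, {g : Aut L M | g • s i = t i} := by
    ext g
    simp [funext_iff]
  rw [this]
  exact isOpen_iInter_of_finite fun i => isOpen_setOf_smul_eq _ _

/-- If `Aut L M` is extremely amenable, no automorphism interchanges two classes of an invariant
equivalence relation on the finite subsets. -/
theorem rel_comp_of_rel_comp_comp {L : FirstOrder.Language.{u, v}} {M : Type w} [Countable M]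
    [L.Structure M] (hG : IsExtremelyAmenable.{w, x} (Aut L M)) {n : ℕ}
    {R : (Fin n → M) → (Fin n → M) → Prop} (hR : IsEquivOnSubsets R)
    (hinv : ∀ (g : Aut L M) (s t : Fin n → M), R s t → R (g ∘ s) (g ∘ t)) (g : Aut L M)
    (s : Fin n → M) (h : R s (g ∘ g ∘ s)) : R s (g ∘ s) := by
  -- `R` fails at tuples with repetitions, so equality is adjoined to obtain reflexivity.
  let E : Setoid (Fin n → M) :=
    { r := fun s t => R s t ∨ s = t
      iseqv :=
        ⟨fun _ => Or.inr rfl, fun h => h.imp (hR.symm _ _) Eq.symm, by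
          rintro s t r (h | rfl) (h' | rfl)
          · exact Or.inl (hR.trans _ _ _ h h')
          · exact Or.inl h
          · exact Or.inl h'
          · exact Or.inr rfl⟩ }
  have key := equiv_smul_of_equiv_smul_smul hG isOpen_setOf_smul_tuple_eq E
    (fun g s t hst => hst.imp (hinv g s t) fun h => by rw [h]) g s (Or.inl (hR.symm _ _ h))
  rcases key with h' | h'
  · exact hR.symm _ _ h'
  · have : g ∘ s = s := h'
    rw [this]
    exact hR.perm s (hR.inj _ _ h).1 1

end Tournament

/-! ### Precompact expansions with quantifier elimination are ultrahomogeneous -/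

section Expansion

/-- The structure on the index set pulled back along a tuple. -/
abbrev tupleStructure (L : FirstOrder.Language.{u, v}) [L.IsRelational] {M : Type w} [L.Structure M]
    {ι : Type x} (a : ι → M) : L.Structure ι where
  funMap f := isEmptyElim f
  RelMap R z := Structure.RelMap R (a ∘ z)

/-- An injective tuple is an embedding of the structure pulled back along it. -/
def tupleEmbedding (L : FirstOrder.Language.{u, v}) [L.IsRelational] {M : Type w} [L.Structure M]
    {ι : Type x} (a : ι → M) (ha : Function.Injective a) :
    letI := tupleStructure L a
    ι ↪[L] M :=
  letI := tupleStructure L a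
  { toFun := a
    inj' := ha
    map_fun' := fun f => isEmptyElim f
    map_rel' := fun _ _ => Iff.rfl }

lemma tupleStructure_eq_iff {L : FirstOrder.Language.{u, v}} [L.IsRelational] {M : Type w}
    [L.Structure M] {ι : Type x} {a b : ι → M} :
    tupleStructure L a = tupleStructure L b ↔
      ∀ (m : ℕ) (R : L.Relations m) (z : Fin m → ι),
        Structure.RelMap R (a ∘ z) ↔ Structure.RelMap R (b ∘ z) := by
  constructor
  · intro h m R z
    have := congrArg (fun S : L.Structure ι => S.RelMap R z) h
    exact Iff.of_eq this
  · intro h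
    refine Structure.ext ?_ ?_
    · funext m f
      exact isEmptyElim f
    · funext m R z
      exact propext (h m R z)

/-- Quantifier-free formulas do not distinguish tuples with the same pulled back structure. -/
lemma realize_iff_of_tupleStructure_eq {L : FirstOrder.Language.{u, v}} [L.IsRelational]
    {M : Type w} [L.Structure M] {ι : Type x} {a b : ι → M} (ha : Function.Injective a)
    (hb : Function.Injective b) (h : tupleStructure L a = tupleStructure L b)
    {ψ : L.Formula ι} (hψ : BoundedFormula.IsQF ψ) : ψ.Realize a ↔ ψ.Realize b := by
  have key : ∀ (c : ι → M) (hc : Function.Injective c), ψ.Realize c ↔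
      @Formula.Realize L ι (tupleStructure L c) _ ψ id := fun c hc => by
    let _ := tupleStructure L c
    have := hψ.realize_embedding (tupleEmbedding L c hc) (v := id) (xs := default)
    rw [Formula.Realize, Formula.Realize, ← this]
    exact iff_of_eq (congrArg _ (Subsingleton.elim _ _))
  rw [key a ha, key b hb, h]

lemma tupleStructure_mem_age {L : FirstOrder.Language.{u, v}} [L.IsRelational] {M : Type w}
    [L.Structure M] {ι : Type w} [Finite ι] (a : ι → M) (ha : Function.Injective a) :
    (⟨ι, tupleStructure L a⟩ : CategoryTheory.Bundled.{w} L.Structure) ∈ L.age M := by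
  let _ := tupleStructure L a
  exact ⟨Structure.FG.of_finite, ⟨tupleEmbedding L a ha⟩⟩

/-- In an ultrahomogeneous structure tuples of the same isomorphism type are conjugate. -/
theorem exists_aut_of_sameIsoType {L : FirstOrder.Language.{u, v}}
    {M : Type w} [L.Structure M] (hu : L.IsUltrahomogeneous M) {k : ℕ} {a b : Fin k → M}
    (h : SameIsoType L a b) : ∃ g : Aut L M, g ∘ a = b := by
  obtain ⟨e, he⟩ := h
  obtain ⟨g, hg⟩ := hu _ (Substructure.fg_closure (Set.finite_range a))
    ((Substructure.closure L (Set.range b)).subtype.comp e.toEmbedding)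
  refine ⟨g, funext fun i => ?_⟩
  have := DFunLike.congr_fun hg ⟨a i, Substructure.subset_closure (Set.mem_range_self i)⟩
  exact this.symm.trans (he i)

/-- Automorphisms of an expansion preserve the relations of the original language. -/
lemma relE_aut {P : Set ℕ} {M : Type w} [(langP P).Structure M] {L' : FirstOrder.Language.{u, v}}
    [L'.Structure M] (φ : langP P →ᴸ L') [φ.IsExpansionOn M] (g : Aut L' M) {n : ℕ} (hn : 0 < n)
    (s t : Fin n → M) : relE P n hn (g ∘ s) (g ∘ t) ↔ relE P n hn s t := by
  have key : ∀ {m : ℕ} (R : (langP P).Relations m) (z : Fin m → M),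
      Structure.RelMap R (g ∘ z) ↔ Structure.RelMap R z := fun R z => by
    rw [← LHom.map_onRelation φ, ← LHom.map_onRelation φ]
    exact g.map_rel _ _
  rw [relE, append_comp_apply]
  exact key _ _

variable {P : Set ℕ} {hP : ∀ n ∈ P, 3 ≤ n}

/-- There are only finitely many structures of the class on a given finite set. -/
lemma finite_setOf_mem_classK (ι : Type w) [Finite ι] :
    {S : (langP P).Structure ι |
      (⟨ι, S⟩ : CategoryTheory.Bundled.{w} (langP P).Structure) ∈ classK P hP}.Finite := by
  classical
  let k := Nat.card ι
  -- All relations vanish on tuples with repetitions, so the finitely many sizes up to `card ι`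
  -- determine the structure.
  let d : (langP P).Structure ι → ∀ n : Fin (k + 1),
      ((Fin n → ι) → (Fin n → ι) → Prop) × ((Fin n → ι) → (Fin n → ι) → Prop) := fun S n =>
    (fun s t => ∃ hn : 0 < (n : ℕ), @relE P ι S n hn s t,
      fun s t => ∃ hn : (n : ℕ) ∈ P, @relLt P ι S n hn s t)
  refine Set.Finite.of_finite_image (f := d) (Set.toFinite _) ?_
  rintro S ⟨-, hSE, hSlt⟩ S' ⟨-, hSE', hSlt'⟩ hd
  have hcard : ∀ {n : ℕ} {s : Fin n → ι}, Function.Injective s → n < k + 1 := fun {n s} hs => by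
    have := Nat.card_le_card_of_injective s hs
    rw [Nat.card_fin] at this
    exact Nat.lt_succ_of_le this
  have hE : ∀ (n : ℕ) (hn : 0 < n) (s t : Fin n → ι), @relE P ι S n hn s t ↔
      @relE P ι S' n hn s t := fun n hn s t => by
    by_cases hs : Function.Injective s
    · have := congrFun (congrFun (congrArg Prod.fst (congrFun hd ⟨n, hcard hs⟩)) s) t
      simpa [d, hn] using this
    · exact ⟨fun h => absurd ((hSE n hn).inj s t h).1 hs,
        fun h => absurd ((hSE' n hn).inj s t h).1 hs⟩
  have hlt : ∀ (n : ℕ) (hn : n ∈ P) (s t : Fin n → ι), @relLt P ι S n hn s t ↔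
      @relLt P ι S' n hn s t := fun n hn s t => by
    by_cases hs : Function.Injective s
    · have := congrFun (congrFun (congrArg Prod.snd (congrFun hd ⟨n, hcard hs⟩)) s) t
      simpa [d, hn] using this
    · exact ⟨fun h => absurd ((hSlt n hn).inj s t h).1 hs,
        fun h => absurd ((hSlt' n hn).inj s t h).1 hs⟩
  refine Structure.ext ?_ ?_
  · funext m f
    exact isEmptyElim f
  · funext m R z
    exact propext (@relMap_comp_iff P ι ι S S' ι id id hE hlt m R z)

variable {M : Type w} [(langP P).Structure M]
  {L' : FirstOrder.Language.{u, v}} [L'.IsRelational] [L'.Structure M]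

/-- A precompact expansion induces only finitely many structures on a finite set. -/
lemma finite_range_tupleStructure [Countable M] (hM : IsFraisseLimit (classK.{w} P hP) M) (φ : langP P →ᴸ L')
    [φ.IsExpansionOn M] (hpre : IsPrecompactExpansion φ M) (ι : Type*) [Finite ι] :
    {S : L'.Structure ι | ∃ a : ι → M, Function.Injective a ∧ S = tupleStructure L' a}.Finite := by
  obtain ⟨k, ⟨f⟩⟩ := Finite.exists_equiv_fin ι
  -- The age consists of structures in the universe of `M`, hence the passage to a lifted copy of
  -- `Fin k`.
  let j : ι ≃ ULift.{w} (Fin k) := f.trans Equiv.ulift.symm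
  let D : Set (L'.Structure (ULift.{w} (Fin k))) :=
    {S | ∃ a : ULift.{w} (Fin k) → M, Function.Injective a ∧ S = tupleStructure L' a}
  have hD : D.Finite := by
    have h1 := finite_setOf_mem_classK (P := P) (hP := hP) (ULift.{w} (Fin k))
    refine (h1.biUnion (t := fun S₀ => {S : L'.Structure (ULift.{w} (Fin k)) |
      @LHom.IsExpansionOn _ L' φ (ULift.{w} (Fin k)) S₀ S ∧
        (⟨_, S⟩ : CategoryTheory.Bundled.{w} L'.Structure) ∈ L'.age M}) fun S₀ hS₀ => ?_).subset ?_
    · exact hpre ⟨_, S₀⟩ (by rw [hM.age]; exact hS₀)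
    · rintro S ⟨a, ha, rfl⟩
      refine Set.mem_biUnion (x := tupleStructure (langP P) a) ?_ ⟨?_, tupleStructure_mem_age a ha⟩
      · change _ ∈ classK P hP
        rw [← hM.age]
        exact tupleStructure_mem_age a ha
      · refine @LHom.IsExpansionOn.mk _ _ φ _ (tupleStructure (langP P) a) (tupleStructure L' a)
          (fun f => isEmptyElim f) fun R z => ?_
        exact LHom.map_onRelation φ R (a ∘ z)
  let c : L'.Structure (ULift.{w} (Fin k)) → L'.Structure ι := fun S =>
    ⟨fun f => isEmptyElim f, fun R z => S.RelMap R (j ∘ z)⟩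
  refine (hD.image c).subset ?_
  rintro S ⟨a, ha, rfl⟩
  refine ⟨tupleStructure L' (a ∘ j.symm), ⟨_, ha.comp j.symm.injective, rfl⟩, ?_⟩
  have h : ∀ (m : ℕ) (z : Fin m → ι), (a ∘ j.symm) ∘ j ∘ z = a ∘ z := fun m z => by
    funext i
    simp
  refine Structure.ext ?_ ?_
  · funext m f
    exact isEmptyElim f
  · funext m R z
    change Structure.RelMap R ((a ∘ j.symm) ∘ j ∘ z) = Structure.RelMap R (a ∘ z)
    rw [h]

/-- The tuples inducing a given structure form a definable set. -/
lemma definable_setOf_tupleStructure_eq {ι : Type} [Finite ι]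
    (hfin : {S : L'.Structure ι | ∃ a : ι → M, Function.Injective a ∧ S = tupleStructure L' a}.Finite)
    (a : ι → M) :
    (∅ : Set M).Definable L'
      {b : ι → M | Function.Injective b ∧ tupleStructure L' b = tupleStructure L' a} := by
  have := hfin.to_subtype
  set D := {S : L'.Structure ι | ∃ a : ι → M, Function.Injective a ∧ S = tupleStructure L' a}
  have hrel : ∀ (m : ℕ) (R : L'.Relations m) (z : Fin m → ι),
      (∅ : Set M).Definable L' {b : ι → M | Structure.RelMap R (b ∘ z)} := fun m R z => by
    rw [Set.empty_definable_iff]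
    refine ⟨R.formula fun i => Term.var (z i), ?_⟩
    ext b
    simp [Function.comp_def]
  have hinj : (∅ : Set M).Definable L' {b : ι → M | Function.Injective b} := by
    have : {b : ι → M | Function.Injective b} =
        ⋂ p : {p : ι × ι // p.1 ≠ p.2}, {b : ι → M | b p.1.1 = b p.1.2}ᶜ := by
      ext b
      simp only [Set.mem_iInter, Set.mem_compl_iff, Set.mem_ofPred_eq, Subtype.forall, Prod.forall]
      exact ⟨fun h i j hij h' => hij (h h'), fun h i j h' => not_not.1 fun hij => h i j hij h'⟩
    rw [this]
    refine Set.definable_iInter_of_finite fun p => Set.Definable.compl ?_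
    rw [Set.empty_definable_iff]
    refine ⟨(Term.var p.1.1).equal (Term.var p.1.2), ?_⟩
    ext b
    simp
  -- One literal separates the given structure from each other one. As only finitely many structures
  -- occur, a finite intersection suffices even though the language may be infinite.
  have hsep : ∀ S : D, ∃ T : Set (ι → M), (∅ : Set M).Definable L' T ∧
      (∀ b, tupleStructure L' b = tupleStructure L' a → b ∈ T) ∧
      (S.1 ≠ tupleStructure L' a → ∀ b, S.1 = tupleStructure L' b → b ∉ T) := by
    rintro ⟨S, c, hc, rfl⟩
    by_cases hS : tupleStructure L' c = tupleStructure L' a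
    · exact ⟨Set.univ, Set.definable_univ, fun _ _ => Set.mem_univ _, fun h => absurd hS h⟩
    · have hS' := hS
      rw [tupleStructure_eq_iff] at hS'
      push Not at hS'
      obtain ⟨m, R, z, hz⟩ := hS'
      rcases hz with ⟨h1, h2⟩ | ⟨h1, h2⟩
      · refine ⟨_, (hrel m R z).compl, fun b hb => ?_, fun _ b hb => ?_⟩
        · exact fun h => h2 ((tupleStructure_eq_iff.1 hb m R z).1 h)
        · exact fun h => h ((tupleStructure_eq_iff.1 hb m R z).1 h1)
      · refine ⟨_, hrel m R z, fun b hb => ?_, fun _ b hb => ?_⟩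
        · exact (tupleStructure_eq_iff.1 hb m R z).2 h2
        · exact fun h => h1 ((tupleStructure_eq_iff.1 hb m R z).2 h)
  choose T hT hmem hnot using hsep
  have : {b : ι → M | Function.Injective b ∧ tupleStructure L' b = tupleStructure L' a} =
      {b : ι → M | Function.Injective b} ∩ ⋂ S : D, T S := by
    ext b
    refine and_congr_right fun hb => ?_
    rw [Set.mem_iInter]
    refine ⟨fun h S => hmem S b h, fun h => ?_⟩
    by_contra hne
    exact hnot ⟨_, b, hb, rfl⟩ hne b rfl (h _)
  rw [this]
  exact hinj.inter (Set.definable_iInter_of_finite hT)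

/-- The one-point extension step of a back-and-forth. That a tuple extends to one inducing a
prescribed structure is definable, so by quantifier elimination it depends only on the structure the
tuple itself induces. -/
lemma exists_extend_tuple (hqe : HasQE L' M)
    (hfin : ∀ k : ℕ, {S : L'.Structure (Fin k) |
      ∃ a : Fin k → M, Function.Injective a ∧ S = tupleStructure L' a}.Finite)
    {k : ℕ} {a b : Fin k → M} (hb : Function.Injective b)
    (h : tupleStructure L' a = tupleStructure L' b) {c : M}
    (hc : Function.Injective (Fin.snoc a c : Fin (k + 1) → M)) :
    ∃ d : M, Function.Injective (Fin.snoc b d : Fin (k + 1) → M) ∧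
      tupleStructure L' (Fin.snoc b d : Fin (k + 1) → M) =
        tupleStructure L' (Fin.snoc a c : Fin (k + 1) → M) := by
  have hinit : ∀ (a : Fin k → M) (c : M), (Fin.snoc a c : Fin (k + 1) → M) ∘ Fin.castSucc = a :=
    fun a c => by funext i; simp
  have ha : Function.Injective a := hinit a c ▸ hc.comp (Fin.castSucc_injective k)
  have hdef := (definable_setOf_tupleStructure_eq (hfin (k + 1))
    (Fin.snoc a c : Fin (k + 1) → M)).image_comp Fin.castSucc
  rw [Set.empty_definable_iff] at hdef
  obtain ⟨θ, hθ⟩ := hdef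
  obtain ⟨ψ, hψ, hiff⟩ := hqe k θ
  have hmem : ∀ e : Fin k → M, θ.Realize e ↔ ∃ f : Fin (k + 1) → M,
      (Function.Injective f ∧ tupleStructure L' f =
        tupleStructure L' (Fin.snoc a c : Fin (k + 1) → M)) ∧ f ∘ Fin.castSucc = e := fun e =>
    Iff.of_eq (congrArg (e ∈ ·) hθ).symm
  have h1 : θ.Realize a := (hmem a).2 ⟨_, ⟨hc, rfl⟩, hinit a c⟩
  rw [hiff, realize_iff_of_tupleStructure_eq ha hb h hψ, ← hiff, hmem] at h1
  obtain ⟨f, ⟨hf, hf'⟩, rfl⟩ := h1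
  have hsn : (Fin.snoc (f ∘ Fin.castSucc) (f (Fin.last k)) : Fin (k + 1) → M) = f := by
    funext i
    refine Fin.lastCases ?_ (fun i => ?_) i <;> simp
  exact ⟨f (Fin.last k), hsn.symm ▸ hf, hsn.symm ▸ hf'⟩

/-- If finitely many structures are induced on each finite set, quantifier elimination implies
ultrahomogeneity. -/
theorem isUltrahomogeneous_of_hasQE [Countable M] (hqe : HasQE L' M)
    (hfin : ∀ k : ℕ, {S : L'.Structure (Fin k) |
      ∃ a : Fin k → M, Function.Injective a ∧ S = tupleStructure L' a}.Finite) :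
    L'.IsUltrahomogeneous M := by
  rw [isUltrahomogeneous_iff_IsExtensionPair Structure.cg_of_countable]
  intro f m
  by_cases hm : m ∈ f.1.dom
  · exact ⟨f, hm, le_rfl⟩
  have : Finite f.1.dom := f.2.finite
  obtain ⟨k, ⟨j⟩⟩ := Finite.exists_equiv_fin f.1.dom
  let a : Fin k → M := fun i => j.symm i
  let b : Fin k → M := fun i => f.1.toEquiv (j.symm i)
  have ha : Function.Injective a := Subtype.val_injective.comp j.symm.injective
  have hb : Function.Injective b :=
    Subtype.val_injective.comp (f.1.toEquiv.injective.comp j.symm.injective)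
  have hab : tupleStructure L' a = tupleStructure L' b := by
    rw [tupleStructure_eq_iff]
    intro l R z
    exact (f.1.toEquiv.map_rel R (j.symm ∘ z)).symm
  have hc : Function.Injective (Fin.snoc a m : Fin (k + 1) → M) := by
    rw [Fin.snoc_injective_iff]
    refine ⟨ha, ?_⟩
    rintro ⟨i, rfl⟩
    exact hm (j.symm i).2
  obtain ⟨d, hd, hd'⟩ := exists_extend_tuple hqe hfin hb hab hc
  let g : M ≃ₚ[L'] M := tuplePartialEquiv _ _ hc hd (tupleStructure_eq_iff.1 hd'.symm)
  have hga : ∀ i : Fin k, a i ∈ g.dom := fun i => ⟨i.castSucc, by simp⟩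
  have hdom : f.1.dom ≤ g.dom := fun p hp => by
    have := hga (j ⟨p, hp⟩)
    simpa [a] using this
  refine ⟨⟨g, setSubstructure_fg (Set.finite_range _)⟩, ⟨Fin.last k, by simp⟩, ?_⟩
  change f.1 ≤ g
  rw [PartialEquiv.le_def]
  refine ⟨hdom, ?_⟩
  ext p
  obtain ⟨i, rfl⟩ := j.symm.surjective p
  have h1 := tuplePartialEquiv_apply _ _ hc hd (tupleStructure_eq_iff.1 hd'.symm) i.castSucc
    ⟨i.castSucc, rfl⟩
  simp only [Fin.snoc_castSucc] at h1
  exact h1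

/-- By ultrahomogeneity one automorphism takes the first pair of tuples to the middle pair and the
middle pair to the last. The first and last pairs are `E_{2n}`-equivalent, so it would interchange
two classes. -/
theorem not_exists_isIncreasingZ4 [Countable M] (hM : IsFraisseLimit (classK.{w} P hP) M) (φ : langP P →ᴸ L')
    [φ.IsExpansionOn M] (hpre : IsPrecompactExpansion φ M) (hqe : HasQE L' M)
    (hG : IsExtremelyAmenable.{w, x} (Aut L' M)) (n : ℕ) (hn : 0 < n) :
    ¬ ∃ a : Fin 6 → (Fin n → M), IsIncreasingZ4 P L' n hn a := by
  rintro ⟨a, -, -, h, hE, hnE⟩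
  have hu := isUltrahomogeneous_of_hasQE hqe fun k => finite_range_tupleStructure hM φ hpre (Fin k)
  obtain ⟨g, hg⟩ := exists_aut_of_sameIsoType hu h
  rw [← append_comp_apply] at hg
  have h1 := congrArg (· ∘ Fin.castAdd (n + n)) hg
  have h2 := congrArg (· ∘ Fin.natAdd (n + n)) hg
  simp only [append_comp_castAdd, append_comp_natAdd] at h1 h2
  rw [← h1] at hnE
  rw [← h2, ← h1] at hE
  exact hnE (rel_comp_of_rel_comp_comp hG (isEquivOnSubsets_of_isFraisseLimit hM _ _)
    (fun g s t => (relE_aut φ g _ s t).2) g _ hE)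

end Expansion

/-! ### Expansions by a linear order -/

section LinearOrder

variable {P : Set ℕ} {hP : ∀ n ∈ P, 3 ≤ n}

/-- The language `L'` expands `langP P`, and any two finite tuples in `M` with the same
`langP P`-relations and the same order type are conjugate under `L'`-automorphisms. -/
def IsOrderHomogeneous (P : Set ℕ) (L' : FirstOrder.Language.{u, v}) (M : Type w)
    [(langP P).Structure M] [L'.Structure M] [LinearOrder M] : Prop :=
  ∀ {k : ℕ} (a b : Fin k → M), StrictMono a → StrictMono b →
    (∀ (n : ℕ) (hn : 0 < n) (s t : Fin n → Fin k), Function.Injective s → Function.Injective t →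
      (relE P n hn (a ∘ s) (a ∘ t) ↔ relE P n hn (b ∘ s) (b ∘ t))) →
    (∀ (n : ℕ) (hn : n ∈ P) (s t : Fin n → Fin k), Function.Injective s → Function.Injective t →
      (relLt P n hn (a ∘ s) (a ∘ t) ↔ relLt P n hn (b ∘ s) (b ∘ t))) →
    ∃ g : Aut L' M, ∀ i, g (a i) = b i

variable {M : Type w} [Countable M] [(langP P).Structure M]

/-- Reduces ultrahomogeneity to comparing increasing enumerations: these agree on the order
automatically, and relations only need to be compared on tuples without repetitions. -/
lemma isOrderHomogeneous_orderExpansion (hM : IsFraisseLimit (classK.{w} P hP) M)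
    (o : LinearOrder M) :
    letI := orderExpansion (langP P) M o
    ((langP P).sum FirstOrder.Language.order).IsUltrahomogeneous M →
      IsOrderHomogeneous P ((langP P).sum FirstOrder.Language.order) M := by
  intro hu k a b ha hb hE hlt
  let _ := orderExpansion (langP P) M o
  refine exists_aut_of_relMap_iff hu a b ha.injective hb.injective ?_
  have hE' : ∀ (n : ℕ) (hn : 0 < n) (s t : Fin n → Fin k),
      relE P n hn (a ∘ s) (a ∘ t) ↔ relE P n hn (b ∘ s) (b ∘ t) := fun n hn s t => by
    have hinj := (isEquivOnSubsets_of_isFraisseLimit hM n hn).inj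
    by_cases hst : Function.Injective s ∧ Function.Injective t
    · exact hE n hn s t hst.1 hst.2
    · exact ⟨fun h => absurd ⟨(hinj _ _ h).1.of_comp, (hinj _ _ h).2.of_comp⟩ hst,
        fun h => absurd ⟨(hinj _ _ h).1.of_comp, (hinj _ _ h).2.of_comp⟩ hst⟩
  have hlt' : ∀ (n : ℕ) (hn : n ∈ P) (s t : Fin n → Fin k),
      relLt P n hn (a ∘ s) (a ∘ t) ↔ relLt P n hn (b ∘ s) (b ∘ t) := fun n hn s t => by
    have hinj := (isLinearOrderOnClasses_of_isFraisseLimit hM n hn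
      (Nat.lt_of_lt_of_le (by decide) (hP n hn))).inj
    by_cases hst : Function.Injective s ∧ Function.Injective t
    · exact hlt n hn s t hst.1 hst.2
    · exact ⟨fun h => absurd ⟨(hinj _ _ h).1.of_comp, (hinj _ _ h).2.of_comp⟩ hst,
        fun h => absurd ⟨(hinj _ _ h).1.of_comp, (hinj _ _ h).2.of_comp⟩ hst⟩
  rintro m (R | R) z
  · exact relMap_comp_iff hE' hlt' m R z
  · cases R
    change a (z 0) ≤ a (z 1) ↔ b (z 0) ≤ b (z 1)
    rw [ha.le_iff_le, hb.le_iff_le]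

/-! ### Convexity of the `E_1`-classes and the interchange of two `E_2`-classes -/

variable {L' : FirstOrder.Language.{u, v}} [L'.Structure M]

/-- The relation `E_1` on elements. -/
def relE₁ (P : Set ℕ) {C : Type w} [(langP P).Structure C] (p q : C) : Prop :=
  relE P 1 Nat.one_pos (fun _ => p) (fun _ => q)

lemma relE₁_equivalence (hM : IsFraisseLimit (classK.{w} P hP) M) :
    Equivalence (relE₁ P (C := M)) :=
  have h := isEquivOnSubsets_of_isFraisseLimit hM 1 Nat.one_pos
  ⟨fun _ => h.perm _ (Function.injective_of_subsingleton _) 1, fun h' => h.symm _ _ h',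
    fun h1 h2 => h.trans _ _ _ h1 h2⟩

/-- The classes of `E_1` are convex. -/
lemma relE₁_of_lt_of_lt [LinearOrder M] (hM : IsFraisseLimit (classK.{w} P hP) M) (φ : langP P →ᴸ L')
    [φ.IsExpansionOn M] (hhom : IsOrderHomogeneous P L' M)
    (hG : IsExtremelyAmenable.{w, x} (Aut L' M)) {p q r : M} (hpq : p < q) (hqr : q < r)
    (hpr : relE₁ P p r) : relE₁ P p q := by
  by_contra hne
  have heq := relE₁_equivalence hM
  have hne' : ¬ relE₁ P q r := fun h => hne (heq.trans hpr (heq.symm h))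
  -- The increasing pairs `(p, q)` and `(q, r)` are isomorphic: both are `E_1`-inequivalent, a
  -- two-element set has only one subset of size two, and orders start at size three. The resulting
  -- `g` maps `p` to `q` and `q` to `r`, so it interchanges two `E_1`-classes.
  obtain ⟨g, hg⟩ : ∃ g : Aut L' M, ∀ i, g (![p, q] i) = ![q, r] i := by
    refine hhom ![p, q] ![q, r] (Fin.strictMono_iff_lt_succ.2 fun i => by fin_cases i; exact hpq)
      (Fin.strictMono_iff_lt_succ.2 fun i => by fin_cases i; exact hqr) ?_ ?_
    · intro n hn s t hs ht
      have hE := isEquivOnSubsets_of_isFraisseLimit hM n hn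
      have hpq' : Function.Injective ![p, q] :=
        (Fin.strictMono_iff_lt_succ.2 fun i => by fin_cases i; exact hpq).injective
      have hqr' : Function.Injective ![q, r] :=
        (Fin.strictMono_iff_lt_succ.2 fun i => by fin_cases i; exact hqr).injective
      have hn2 : n ≤ 2 := by simpa using Fintype.card_le_of_injective s hs
      interval_cases n
      · have e : ∀ (a : Fin 2 → M) (s : Fin 1 → Fin 2), a ∘ s = fun _ => a (s 0) := fun a s => by
          funext i
          rw [Subsingleton.elim i 0]
          rfl
        rw [e, e, e, e]
        change relE₁ P _ _ ↔ relE₁ P _ _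
        generalize s 0 = i
        generalize t 0 = j
        fin_cases i <;> fin_cases j
        · exact iff_of_true (heq.refl _) (heq.refl _)
        · exact iff_of_false hne hne'
        · exact iff_of_false (fun h => hne (heq.symm h)) fun h => hne' (heq.symm h)
        · exact iff_of_true (heq.refl _) (heq.refl _)
      · obtain ⟨σ, rfl⟩ : ∃ σ : Equiv.Perm (Fin 2), t = s ∘ σ :=
          ⟨(Equiv.ofBijective t (Finite.injective_iff_bijective.1 ht)).trans
            (Equiv.ofBijective s (Finite.injective_iff_bijective.1 hs)).symm, by
            funext i
            exact ((Equiv.ofBijective s (Finite.injective_iff_bijective.1 hs)).apply_symm_apply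
              (t i)).symm⟩
        exact iff_of_true (hE.perm _ (hpq'.comp hs) σ) (hE.perm _ (hqr'.comp hs) σ)
    · intro n hn s t hs ht
      have : n ≤ 2 := by simpa using Fintype.card_le_of_injective s hs
      exact absurd (hP n hn) (by omega)
  have hp : g p = q := hg 0
  have hq : g q = r := hg 1
  refine hne ?_
  have := rel_comp_of_rel_comp_comp hG (isEquivOnSubsets_of_isFraisseLimit hM 1 Nat.one_pos)
    (fun g s t => (relE_aut φ g _ s t).2) g (fun _ => p)
  simp only [Function.comp_def, hp, hq] at this
  exact this hpr

/-- Convexity makes the order between points of distinct `E_1`-classes depend only on the classes.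
-/
lemma lt_of_relE₁ [LinearOrder M] (hM : IsFraisseLimit (classK.{w} P hP) M)
    (hconv : ∀ {p q r : M}, p < q → q < r → relE₁ P p r → relE₁ P p q)
    {p p' q q' : M} (hp : relE₁ P p p') (hq : relE₁ P q q') (hpq : ¬ relE₁ P p q) (h : p < q) :
    p' < q' := by
  have heq := relE₁_equivalence hM
  have h1 : p' < q := by
    rcases lt_trichotomy p' q with h1 | h1 | h1
    · exact h1
    · exact absurd (h1 ▸ hp) hpq
    · exact absurd (hconv h h1 hp) hpq
  rcases lt_trichotomy p' q' with h2 | h2 | h2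
  · exact h2
  · exact absurd (heq.trans hp (h2 ▸ heq.symm hq)) hpq
  · exact absurd (heq.trans (heq.trans hp (heq.symm (hconv h2 h1 (heq.symm hq))))
      (heq.symm hq)) hpq

/-- Twelve points in three blocks; each block contains an edge of each of two colours. -/
abbrev EdgePoint : Type := Fin 3 × Fin 2 × Fin 2

/-- The colour of a pair of points: `0` if the pair is not an edge. -/
def edgeColour (p q : EdgePoint) : ℕ := if p.1 = q.1 ∧ p.2.1 = q.2.1 then p.2.1 + 1 else 0

open Classical in
/-- Points are labelled by their block and pairs by their colour. -/
noncomputable def edgeLabel (S : Set EdgePoint) : ℕ :=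
  if h : ∃ p, S = {p} then h.choose.1
  else if h : ∃ z : EdgePoint × EdgePoint, z.1 ≠ z.2 ∧ S = {z.1, z.2} then
    edgeColour h.choose.1 h.choose.2
  else 0

lemma edgeColour_comm (p q : EdgePoint) : edgeColour p q = edgeColour q p := by
  unfold edgeColour
  by_cases h : p.1 = q.1 ∧ p.2.1 = q.2.1
  · rw [if_pos h, if_pos ⟨h.1.symm, h.2.symm⟩, h.2]
  · rw [if_neg h, if_neg fun h' => h ⟨h'.1.symm, h'.2.symm⟩]

lemma edgeLabel_singleton (p : EdgePoint) : edgeLabel {p} = p.1 := by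
  have h : ∃ q, ({p} : Set EdgePoint) = {q} := ⟨p, rfl⟩
  rw [edgeLabel, dif_pos h, ← Set.singleton_injective h.choose_spec]

lemma edgeLabel_pair {p q : EdgePoint} (hpq : p ≠ q) : edgeLabel {p, q} = edgeColour p q := by
  have h1 : ¬ ∃ r, ({p, q} : Set EdgePoint) = {r} := by
    rintro ⟨r, hr⟩
    have hp : p ∈ ({r} : Set EdgePoint) := hr ▸ Set.mem_insert p _
    have hq : q ∈ ({r} : Set EdgePoint) := hr ▸ Set.mem_insert_of_mem p rfl
    exact hpq (hp.trans hq.symm)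
  have h2 : ∃ z : EdgePoint × EdgePoint, z.1 ≠ z.2 ∧ ({p, q} : Set EdgePoint) = {z.1, z.2} :=
    ⟨(p, q), hpq, rfl⟩
  rw [edgeLabel, dif_neg h1, dif_pos h2]
  rcases (Set.pair_eq_pair_iff).1 h2.choose_spec.2 with h | h
  · rw [← h.1, ← h.2]
  · rw [← h.1, ← h.2, edgeColour_comm]

lemma edgeLabel_range_of_three_le {n : ℕ} (hn : 3 ≤ n) {s : Fin n → EdgePoint}
    (hs : Function.Injective s) : edgeLabel (Set.range s) = 0 := by
  have hcard : (Set.range s).ncard = n := by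
    rw [← Nat.card_coe_set_eq, Nat.card_range_of_injective hs, Nat.card_fin]
  rw [edgeLabel, dif_neg, dif_neg]
  · rintro ⟨z, hz, hz'⟩
    rw [hz', Set.ncard_pair hz] at hcard
    omega
  · rintro ⟨p, hp⟩
    rw [hp, Set.ncard_singleton] at hcard
    omega

/-- Configurations of two edges in different blocks and of different colours are isomorphic. -/
lemma edgeLabel_eq_iff {α β : Fin 4 → EdgePoint} (hα : Function.Injective α)
    (hβ : Function.Injective β)
    (h1 : ∀ i j, (α i).1 = (α j).1 ↔ (β i).1 = (β j).1)
    (h2 : ∀ i j k l, edgeColour (α i) (α j) = edgeColour (α k) (α l) ↔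
      edgeColour (β i) (β j) = edgeColour (β k) (β l))
    {n : ℕ} (hn : 0 < n) (s t : Fin n → Fin 4) (hs : Function.Injective s)
    (ht : Function.Injective t) :
    edgeLabel (Set.range (α ∘ s)) = edgeLabel (Set.range (α ∘ t)) ↔
      edgeLabel (Set.range (β ∘ s)) = edgeLabel (Set.range (β ∘ t)) := by
  obtain rfl | rfl | h3 : n = 1 ∨ n = 2 ∨ 3 ≤ n := by omega
  · have e : ∀ γ : Fin 1 → EdgePoint, edgeLabel (Set.range γ) = (γ 0).1 := fun γ => by
      rw [Set.range_unique, edgeLabel_singleton]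
      rfl
    rw [e, e, e, e, Fin.val_inj, Fin.val_inj]
    exact h1 _ _
  · have e : ∀ γ : Fin 2 → EdgePoint, Function.Injective γ →
        edgeLabel (Set.range γ) = edgeColour (γ 0) (γ 1) := fun γ hγ => by
      have hr : Set.range γ = {γ 0, γ 1} := by
        ext p
        simp [Fin.exists_fin_two, eq_comm]
      rw [hr, edgeLabel_pair (hγ.ne (by decide))]
    rw [e _ (hα.comp hs), e _ (hα.comp ht), e _ (hβ.comp hs), e _ (hβ.comp ht)]
    exact h2 _ _ _ _
  · rw [edgeLabel_range_of_three_le h3 (hα.comp hs), edgeLabel_range_of_three_le h3 (hα.comp ht),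
      edgeLabel_range_of_three_le h3 (hβ.comp hs), edgeLabel_range_of_three_le h3 (hβ.comp ht)]

/-- Convexity orders the three blocks. Since `E_2` does not name its classes, an edge of the first
colour in the lowest block followed by one of the second colour in the middle block is isomorphic to
the latter edge followed by one of the first colour in the highest block. The automorphism realizing
this interchanges the two colours. -/
theorem not_isExtremelyAmenable_of_isOrderHomogeneous [LinearOrder M]
    (hM : IsFraisseLimit (classK.{w} P hP) M) (φ : langP P →ᴸ L') [φ.IsExpansionOn M] (hhom : IsOrderHomogeneous P L' M) :
    ¬ IsExtremelyAmenable.{w, x} (Aut L' M) := by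
  intro hG
  have hconv := fun {p q r : M} => relE₁_of_lt_of_lt (p := p) (q := q) (r := r) hM φ hhom hG
  obtain ⟨e, he, heE, helt⟩ := exists_labelled_embedding hM edgeLabel
  have hE1 : ∀ p q : EdgePoint, relE₁ P (e p) (e q) ↔ p.1 = q.1 := fun p q => by
    have h := heE 1 Nat.one_pos (fun _ => p) (fun _ => q)
    rw [Set.range_const, Set.range_const, edgeLabel_singleton, edgeLabel_singleton,
      Fin.val_inj] at h
    exact h.trans ⟨fun h => h.2.2, fun h =>
      ⟨Function.injective_of_subsingleton _, Function.injective_of_subsingleton _, h⟩⟩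
  have hε : ∀ (b : Fin 3) (c : Fin 2), ∃ x y : Fin 2, x ≠ y ∧ e (b, c, x) < e (b, c, y) := by
    intro b c
    have hne : e (b, c, 0) ≠ e (b, c, 1) := he.ne (by simp)
    rcases lt_or_gt_of_ne hne with h | h
    · exact ⟨0, 1, by decide, h⟩
    · exact ⟨1, 0, by decide, h⟩
  choose l u hlu hlt using hε
  -- The given order is arbitrary, so the blocks are sorted; one representative per block suffices
  -- by convexity.
  obtain ⟨b, hb⟩ : ∃ b : Fin 3 → Fin 3, StrictMono fun i => e (b i, 0, 0) := by
    let m : Fin 3 → M := fun i => e (i, 0, 0)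
    have hm : Function.Injective m := he.comp fun i j h => congrArg Prod.fst h
    exact ⟨Tuple.sort m, (Tuple.monotone_sort m).strictMono_of_injective
      (hm.comp (Tuple.sort m).injective)⟩
  have hbinj : Function.Injective b := fun i j h => hb.injective (by simp only [h])
  have hblock : ∀ i j : Fin 3, i < j → ∀ z z' : Fin 2 × Fin 2, e (b i, z) < e (b j, z') := by
    intro i j hij z z'
    refine lt_of_relE₁ hM hconv ((hE1 (b i, 0, 0) _).2 rfl) ((hE1 (b j, 0, 0) _).2 rfl) ?_ (hb hij)
    rw [hE1]
    exact hbinj.ne hij.ne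
  let α : Fin 4 → EdgePoint :=
    ![(b 0, 0, l (b 0) 0), (b 0, 0, u (b 0) 0), (b 1, 1, l (b 1) 1), (b 1, 1, u (b 1) 1)]
  let β : Fin 4 → EdgePoint :=
    ![(b 1, 1, l (b 1) 1), (b 1, 1, u (b 1) 1), (b 2, 0, l (b 2) 0), (b 2, 0, u (b 2) 0)]
  have hα : StrictMono (e ∘ α) := Fin.strictMono_iff_lt_succ.2 fun i => by
    fin_cases i
    · exact hlt _ _
    · exact hblock 0 1 (by decide) _ _
    · exact hlt _ _
  have hβ : StrictMono (e ∘ β) := Fin.strictMono_iff_lt_succ.2 fun i => by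
    fin_cases i
    · exact hlt _ _
    · exact hblock 1 2 (by decide) _ _
    · exact hlt _ _
  have h01 : b 0 ≠ b 1 := hbinj.ne (by decide)
  have h12 : b 1 ≠ b 2 := hbinj.ne (by decide)
  have h1 : ∀ i j, (α i).1 = (α j).1 ↔ (β i).1 = (β j).1 := by
    intro i j
    fin_cases i <;> fin_cases j <;> simp [α, β, h01, h12, h01.symm, h12.symm]
  have h2 : ∀ i j k l, edgeColour (α i) (α j) = edgeColour (α k) (α l) ↔
      edgeColour (β i) (β j) = edgeColour (β k) (β l) := by
    -- `α` and `β` have the same edges with the two colours `1` and `2` exchanged, hence `k i + 1`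
    -- against `2 - k i`.
    let k : Fin 4 → Fin 2 := ![0, 0, 1, 1]
    have cα : ∀ i j, edgeColour (α i) (α j) = if k i = k j then (k i : ℕ) + 1 else 0 := by
      intro i j
      fin_cases i <;> fin_cases j <;> simp [α, k, edgeColour]
    have cβ : ∀ i j, edgeColour (β i) (β j) = if k i = k j then 2 - (k i : ℕ) else 0 := by
      intro i j
      fin_cases i <;> fin_cases j <;> simp [β, k, edgeColour]
    simp only [cα, cβ]
    decide
  have hlab := fun {n : ℕ} => edgeLabel_eq_iff (n := n) hα.injective.of_comp hβ.injective.of_comp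
    h1 h2
  obtain ⟨g, hg⟩ := hhom (e ∘ α) (e ∘ β) hα hβ (fun n hn s t hs ht => by
      rw [Function.comp_assoc, Function.comp_assoc, Function.comp_assoc, Function.comp_assoc, heE,
        heE, hlab hn s t hs ht]
      simp only [hα.injective.of_comp.comp hs, hα.injective.of_comp.comp ht,
        hβ.injective.of_comp.comp hs, hβ.injective.of_comp.comp ht])
    (fun n hn s t hs ht => by
      rw [Function.comp_assoc, Function.comp_assoc, Function.comp_assoc, Function.comp_assoc, helt,
        helt, edgeLabel_range_of_three_le (hP n hn) (hα.injective.of_comp.comp hs),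
        edgeLabel_range_of_three_le (hP n hn) (hα.injective.of_comp.comp ht),
        edgeLabel_range_of_three_le (hP n hn) (hβ.injective.of_comp.comp hs),
        edgeLabel_range_of_three_le (hP n hn) (hβ.injective.of_comp.comp ht)]
      simp)
  let edge : Fin 3 → Fin 2 → Fin 2 → EdgePoint := fun i c =>
    ![(b i, c, l (b i) c), (b i, c, u (b i) c)]
  have hedge_inj : ∀ i c, Function.Injective (edge i c) := fun i c => by
    have hne : (b i, c, l (b i) c) ≠ (b i, c, u (b i) c) := fun h => hlu (b i) c (by simpa using h)
    intro x y
    fin_cases x <;> fin_cases y <;> simp [edge, hlu, (hlu _ _).symm]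
  have hedge : ∀ i c, edgeLabel (Set.range (edge i c)) = c + 1 := fun i c => by
    have hr : Set.range (edge i c) = {edge i c 0, edge i c 1} := by
      ext p
      simp [Fin.exists_fin_two, eq_comm]
    rw [hr, edgeLabel_pair ((hedge_inj i c).ne (by decide))]
    simp [edge, edgeColour]
  have hg1 : g ∘ e ∘ edge 0 0 = e ∘ edge 1 1 := by
    funext x
    fin_cases x
    · exact hg 0
    · exact hg 1
  have hg2 : g ∘ e ∘ edge 1 1 = e ∘ edge 2 0 := by
    funext x
    fin_cases x
    · exact hg 2
    · exact hg 3
  have key := rel_comp_of_rel_comp_comp hG (isEquivOnSubsets_of_isFraisseLimit hM 2 Nat.two_pos)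
    (fun g s t => (relE_aut φ g _ s t).2) g (e ∘ edge 0 0)
  rw [hg1, hg2, heE, heE, hedge, hedge, hedge] at key
  have := (key ⟨hedge_inj _ _, hedge_inj _ _, rfl⟩).2.2
  simp at this

theorem not_exists_linearOrder (hM : IsFraisseLimit (classK.{w} P hP) M) :
    ¬ ∃ o : LinearOrder M,
      letI := orderExpansion (langP P) M o
      ((langP P).sum FirstOrder.Language.order).IsUltrahomogeneous M ∧
        IsExtremelyAmenable.{w, x} (Aut ((langP P).sum FirstOrder.Language.order) M) := by
  rintro ⟨o, hu, hG⟩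
  let _ := orderExpansion (langP P) M o
  let _ : FirstOrder.Language.order.Structure M := @FirstOrder.Language.orderStructure M o.toLE
  have : (LHom.sumInl : langP P →ᴸ (langP P).sum FirstOrder.Language.order).IsExpansionOn M :=
    ⟨fun _ _ => rfl, fun _ _ => rfl⟩
  exact not_isExtremelyAmenable_of_isOrderHomogeneous hM LHom.sumInl
    (isOrderHomogeneous_orderExpansion hM o hu) hG

end LinearOrder

/-! ### Extending partial isomorphisms of labelled sets -/

section Valuation

/-- Matching `a i` with `b i` is a bijection between the two ranges, and in a finite set it extends
to a permutation. -/
lemma exists_perm_apply_eq {I B : Type*} [Finite B] (a b : I → B)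
    (h : ∀ i j, a i = a j ↔ b i = b j) : ∃ π : Equiv.Perm B, ∀ i, π (a i) = b i := by
  classical
  have hab : ∀ p : Set.range a, b p.2.choose ∈ Set.range b := fun p => Set.mem_range_self _
  let f : Set.range a → Set.range b := fun p => ⟨b p.2.choose, hab p⟩
  have hf : ∀ i, f ⟨a i, Set.mem_range_self i⟩ = ⟨b i, Set.mem_range_self i⟩ := fun i =>
    Subtype.ext ((h _ _).1 (Set.mem_range_self (f := a) i).choose_spec)
  have hbij : Function.Bijective f := by
    constructor
    · rintro ⟨_, i, rfl⟩ ⟨_, j, rfl⟩ hij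
      rw [hf, hf] at hij
      exact Subtype.ext ((h i j).2 (congrArg Subtype.val hij))
    · rintro ⟨_, i, rfl⟩
      exact ⟨_, hf i⟩
  refine ⟨(Equiv.ofBijective f hbij).extendSubtype, fun i => ?_⟩
  rw [Equiv.extendSubtype_apply_of_mem _ _ (Set.mem_range_self i)]
  exact congrArg Subtype.val (hf i)

lemma finsum_mem_eq_of_forall_ne {B R : Type*} [AddCommMonoid R] {S : Set B} {f : B → R} {q : B}
    (hq : q ∈ S) (h : ∀ p ∈ S, p ≠ q → f p = 0) : ∑ᶠ p ∈ S, f p = f q := by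
  rw [← finsum_mem_singleton (f := f)]
  refine finsum_mem_inter_support_eq' f _ _ fun p hp => ⟨fun hpS => ?_, ?_⟩
  · exact not_not.1 fun hne => hp (h p hpS hne)
  · rintro rfl
    exact hq

/-- Points of `B` together with a valuation of all subsets of `B`. -/
abbrev Valued (B : Type x) (K : ℕ) : Type x := B × (Set B → ZMod K)

open Classical in
/-- The label of a set of valued points which projects injectively to `B` is the sum of the values
of its projection. -/
noncomputable def valuationLabel {B : Type x} {K : ℕ} (T : Set (Valued B K)) : ZMod K :=
  if Set.InjOn Prod.fst T then ∑ᶠ p ∈ T, p.2 (Prod.fst '' T) else 0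

variable {B : Type x} {K : ℕ}

/-- A choice of corrections with vanishing sums that realizes prescribed corrections on `R`. -/
lemma exists_correction [Finite B] (R : Set B) (d : B → Set B → ZMod K)
    (hd : ∀ S ⊆ R, ∑ᶠ p ∈ S, d p S = 0) :
    ∃ τ : B → Set B → ZMod K, (∀ p ∈ R, τ p = d p) ∧ ∀ S, ∑ᶠ p ∈ S, τ p S = 0 := by
  classical
  -- One chosen point of `S` outside `R` absorbs the whole sum of corrections prescribed on `R`;
  -- sets inside `R` have vanishing sum by hypothesis.
  let τ : B → Set B → ZMod K := fun p S =>
    if p ∈ R then d p S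
    else if ∃ h : (S \ R).Nonempty, p = h.some then -∑ᶠ q ∈ S ∩ R, d q S else 0
  have hτR : ∀ p ∈ R, τ p = d p := fun p hp => funext fun S => if_pos hp
  refine ⟨τ, hτR, fun S => ?_⟩
  have h1 : ∑ᶠ p ∈ S ∩ R, τ p S = ∑ᶠ p ∈ S ∩ R, d p S :=
    finsum_mem_congr rfl fun p hp => by rw [hτR p hp.2]
  by_cases hS : (S \ R).Nonempty
  · have h2 : ∑ᶠ p ∈ S \ R, τ p S = -∑ᶠ q ∈ S ∩ R, d q S := by
      rw [finsum_mem_eq_of_forall_ne hS.some_mem fun p hp hne => ?_]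
      · simp only [τ]
        rw [if_neg hS.some_mem.2, if_pos ⟨hS, trivial⟩]
      · simp only [τ]
        rw [if_neg hp.2, if_neg]
        rintro ⟨h, h'⟩
        exact hne h'
    rw [← finsum_mem_inter_add_sdiff R (Set.toFinite S), h1, h2, add_neg_cancel]
  · have hSR : S ⊆ R := by
      rw [← Set.sdiff_eq_empty]
      exact Set.not_nonempty_iff_eq_empty.1 hS
    rw [← hd S hSR]
    exact finsum_mem_congr rfl fun p hp => by rw [hτR p (hSR hp)]

/-- Valued points over `B` are homogeneous: two tuples of valued points with the same labels are
conjugate under a label preserving permutation. -/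
theorem exists_perm_valuationLabel [Finite B] {A : Type*} (α β : A → B) (hα : Function.Injective α)
    (hβ : Function.Injective β) (ξ η : B → Set B → ZMod K)
    (h : ∀ S : Set A, ∑ᶠ p ∈ α '' S, ξ p (α '' S) = ∑ᶠ p ∈ β '' S, η p (β '' S)) :
    ∃ θ : Equiv.Perm (Valued B K), (∀ T, valuationLabel (θ '' T) = valuationLabel T) ∧
      ∀ a, θ (α a, ξ (α a)) = (β a, η (β a)) := by
  classical
  obtain ⟨π, hπ⟩ := exists_perm_apply_eq α β fun i j => by rw [hα.eq_iff, hβ.eq_iff]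
  obtain ⟨τ, hτ, hsum⟩ := exists_correction (Set.range α)
    (fun p S => η (π p) (π '' S) - ξ p S) (K := K) (by
      intro S hS
      obtain ⟨S, rfl⟩ := Set.subset_range_iff_exists_image_eq.1 hS
      have hπS : π '' (α '' S) = β '' S := by
        rw [Set.image_image]
        simp only [hπ]
      rw [finsum_mem_sub_distrib _ _ (Set.toFinite _), h S, ← hπS,
        finsum_mem_image (f := fun p => η p (π '' (α '' S))) π.injective.injOn, sub_self])
  -- Points move by `π` and valuations are shifted by `τ`. As `τ` has zero sum over every set,
  -- labels are unchanged.
  let θ : Equiv.Perm (Valued B K) :=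
    { toFun := fun p => (π p.1, fun S => p.2 (π ⁻¹' S) + τ p.1 (π ⁻¹' S))
      invFun := fun p => (π.symm p.1, fun S => p.2 (π '' S) - τ (π.symm p.1) S)
      left_inv := fun p => by
        refine Prod.ext (π.symm_apply_apply _) (funext fun S => ?_)
        simp only [Set.preimage_image_eq _ π.injective, π.symm_apply_apply, add_sub_cancel_right]
      right_inv := fun p => by
        refine Prod.ext (π.apply_symm_apply _) (funext fun S => ?_)
        simp only [Set.image_preimage_eq _ π.surjective, sub_add_cancel] }
  refine ⟨θ, fun T => ?_, fun a => ?_⟩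
  · have hfst : Prod.fst '' (θ '' T) = π '' (Prod.fst '' T) := by
      rw [Set.image_image, Set.image_image]
      rfl
    have hinj : Set.InjOn Prod.fst (θ '' T) ↔ Set.InjOn Prod.fst T := by
      constructor
      · intro hT p hp q hq hpq
        exact θ.injective (hT (Set.mem_image_of_mem θ hp) (Set.mem_image_of_mem θ hq)
          (congrArg π hpq))
      · rintro hT _ ⟨p, hp, rfl⟩ _ ⟨q, hq, rfl⟩ hpq
        exact congrArg θ (hT hp hq (π.injective hpq))
    unfold valuationLabel
    by_cases hT : Set.InjOn Prod.fst T
    · rw [if_pos (hinj.2 hT), if_pos hT, finsum_mem_image θ.injective.injOn, hfst]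
      have h1 : ∀ p ∈ T, (θ p).2 (π '' (Prod.fst '' T)) =
          p.2 (Prod.fst '' T) + τ p.1 (Prod.fst '' T) := fun p _ => by
        change p.2 (π ⁻¹' (π '' (Prod.fst '' T))) + τ p.1 (π ⁻¹' (π '' (Prod.fst '' T))) = _
        rw [Set.preimage_image_eq _ π.injective]
      have hfin : T.Finite := Set.Finite.of_finite_image (Set.toFinite (Prod.fst '' T)) hT
      rw [finsum_mem_congr rfl h1, finsum_mem_add_distrib hfin,
        ← finsum_mem_image (f := fun p => τ p (Prod.fst '' T)) hT, hsum, add_zero]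
    · rw [if_neg fun h' => hT (hinj.1 h'), if_neg hT]
  · refine Prod.ext (hπ a) (funext fun S => ?_)
    change ξ (α a) (π ⁻¹' S) + τ (α a) (π ⁻¹' S) = η (β a) S
    rw [hτ _ (Set.mem_range_self a)]
    change _ + (η (π (α a)) (π '' (π ⁻¹' S)) - _) = _
    rw [hπ, Set.image_preimage_eq _ π.surjective,
      add_sub_cancel]

open Classical in
/-- A valuation with prescribed sums. -/
noncomputable def valuationOf (f : Set B → ZMod K) (p : B) (S : Set B) : ZMod K :=
  if ∃ h : S.Nonempty, p = h.some then f S else 0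

lemma finsum_valuationOf (f : Set B → ZMod K) {S : Set B} (hS : S.Nonempty) :
    ∑ᶠ p ∈ S, valuationOf f p S = f S := by
  rw [finsum_mem_eq_of_forall_ne hS.some_mem fun p _ hne => ?_]
  · rw [valuationOf, if_pos ⟨hS, rfl⟩]
  · rw [valuationOf, if_neg]
    rintro ⟨h, h'⟩
    exact hne h'

/-- The copy of `B` among the valued points in which every subset `S` has the label `f S`. -/
noncomputable def valuedCopy (f : Set B → ZMod K) (p : B) : Valued B K := (p, valuationOf f p)

lemma valuedCopy_injective (f : Set B → ZMod K) : Function.Injective (valuedCopy f) :=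
  fun _ _ h => congrArg Prod.fst h

lemma valuationLabel_valuedCopy (f : Set B → ZMod K) {S : Set B} (hS : S.Nonempty) :
    valuationLabel (valuedCopy f '' S) = f S := by
  have hfst : Prod.fst '' (valuedCopy f '' S) = S := by
    rw [Set.image_image]
    exact Set.image_id S
  have hinj : Set.InjOn Prod.fst (valuedCopy f '' S) := by
    rintro _ ⟨p, -, rfl⟩ _ ⟨q, -, rfl⟩ h
    exact congrArg (valuedCopy f) h
  rw [valuationLabel, if_pos hinj, hfst, finsum_mem_image (valuedCopy_injective f).injOn]
  exact finsum_valuationOf f hS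

end Valuation

/-! ### Almost invariant families of copies -/

section AlmostInvariant

/-- The permutations of the valued points which preserve all labels. -/
def labelPerms (B : Type x) (K : ℕ) : Subgroup (Equiv.Perm (Valued B K)) where
  carrier := {θ | ∀ T, valuationLabel (θ '' T) = valuationLabel T}
  mul_mem' {θ η} hθ hη T := by
    rw [← hη T, ← hθ (η '' T), Set.image_image]
    rfl
  one_mem' T := by
    rw [Equiv.Perm.coe_one, Set.image_id]
  inv_mem' {θ} hθ T := by
    rw [← hθ ((θ⁻¹ : Equiv.Perm (Valued B K)) '' T), Set.image_image]
    simp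

/-- The families of permutations indexed by sizes of sets which are trivial at sizes in `P`. -/
def relabelPerms (P : Set ℕ) (N k : ℕ) : Subgroup (Fin (N + 1) → Equiv.Perm (Fin k)) where
  carrier := {σ | ∀ n : Fin (N + 1), (n : ℕ) ∈ P → σ n = 1}
  mul_mem' {σ τ} hσ hτ n hn := by
    rw [Pi.mul_apply, hσ n hn, hτ n hn, one_mul]
  one_mem' _ _ := rfl
  inv_mem' {σ} hσ n hn := by
    rw [Pi.inv_apply, hσ n hn, inv_one]

lemma abs_sum_div_card_le {I : Type*} [Fintype I] [Nonempty I] {f : I → ℝ} {C : ℝ}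
    (hf : ∀ i, |f i| ≤ C) : |(∑ i, f i) / Fintype.card I| ≤ C := by
  have h : (0 : ℝ) < Fintype.card I := Nat.cast_pos.2 Fintype.card_pos
  rw [abs_div, abs_of_pos h, div_le_iff₀ h]
  calc |∑ i, f i| ≤ ∑ i, |f i| := Finset.abs_sum_le_sum_abs _ _
    _ ≤ ∑ _i : I, C := Finset.sum_le_sum fun i _ => hf i
    _ = C * Fintype.card I := by simp [mul_comm]

/-- Averaging a function of tuples of valued points over the label preserving permutations. -/
noncomputable def labelAverage {A B : Type*} {K : ℕ} [Fintype (labelPerms B K)]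
    (c : (A → Valued B K) → ℝ) (ρ : A → Valued B K) : ℝ :=
  (∑ θ : labelPerms B K, c (θ.1 ∘ ρ)) / Fintype.card (labelPerms B K)

lemma labelAverage_comp {A B : Type*} {K : ℕ} [Fintype (labelPerms B K)]
    (c : (A → Valued B K) → ℝ) (ρ : A → Valued B K) {θ : Equiv.Perm (Valued B K)}
    (hθ : θ ∈ labelPerms B K) : labelAverage c (θ ∘ ρ) = labelAverage c ρ := by
  unfold labelAverage
  congr 1
  exact Fintype.sum_equiv (Equiv.mulRight ⟨θ, hθ⟩) _ _ fun η => rfl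

/-- The average over the label preserving permutations depends only on the labels. -/
lemma labelAverage_eq {A B : Type*} [Finite B] {K : ℕ} [Fintype (labelPerms B K)]
    (c : (A → Valued B K) → ℝ) {α β : A → B} (hα : Function.Injective α)
    (hβ : Function.Injective β) (f g : Set B → ZMod K)
    (h : ∀ S : Set A, S.Nonempty → f (α '' S) = g (β '' S)) :
    labelAverage c (valuedCopy f ∘ α) = labelAverage c (valuedCopy g ∘ β) := by
  obtain ⟨θ, hθ, hθ'⟩ := exists_perm_valuationLabel α β hα hβ (valuationOf f) (valuationOf g)
    fun S => by
      -- The empty set always has sum zero, so the values of `f` and `g` there do not matter.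
      rcases S.eq_empty_or_nonempty with rfl | hS
      · simp
      · rw [finsum_valuationOf f (hS.image α), finsum_valuationOf g (hS.image β), h S hS]
  have : valuedCopy g ∘ β = θ ∘ valuedCopy f ∘ α := funext fun a => (hθ' a).symm
  rw [this]
  exact (labelAverage_comp c _ hθ).symm

lemma mul_add_lt_mul_add_iff {k a b p q : ℕ} (hp : p < k) (hq : q < k) :
    a * k + p < b * k + q ↔ a < b ∨ a = b ∧ p < q := by
  rcases lt_trichotomy a b with h | rfl | h
  · have : (a + 1) * k ≤ b * k := Nat.mul_le_mul_right k h
    rw [add_mul] at this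
    constructor <;> intro _ <;> omega
  · constructor <;> intro _ <;> omega
  · have : (b + 1) * k ≤ a * k := Nat.mul_le_mul_right k h
    rw [add_mul] at this
    constructor <;> intro _ <;> omega

/-! ### Relabelling at each size, and averaging over relabellings -/

variable {B : Type y} [Finite B] {k : ℕ}

/-- The index of the size of a subset. -/
noncomputable def sizeIndex (S : Set B) : Fin (Nat.card B + 1) :=
  ⟨S.ncard, Nat.lt_succ_of_le (Set.ncard_le_card S)⟩

/-- Labels of different sizes are put into disjoint blocks. -/
noncomputable def blockLabel (lab : Set B → Fin k) (σ : Fin (Nat.card B + 1) → Equiv.Perm (Fin k))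
    (S : Set B) : ℕ :=
  S.ncard * k + σ (sizeIndex S) (lab S)

lemma blockLabel_lt (lab : Set B → Fin k) (σ : Fin (Nat.card B + 1) → Equiv.Perm (Fin k))
    (S : Set B) : blockLabel lab σ S < (Nat.card B + 1) * k := by
  have h1 : S.ncard * k ≤ Nat.card B * k := Nat.mul_le_mul_right k (Set.ncard_le_card S)
  have h2 := (σ (sizeIndex S) (lab S)).2
  rw [blockLabel, add_mul]
  omega

lemma blockLabel_lt_iff (lab : Set B → Fin k) (σ : Fin (Nat.card B + 1) → Equiv.Perm (Fin k))
    (S T : Set B) : blockLabel lab σ S < blockLabel lab σ T ↔ S.ncard < T.ncard ∨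
      S.ncard = T.ncard ∧ σ (sizeIndex S) (lab S) < σ (sizeIndex T) (lab T) :=
  mul_add_lt_mul_add_iff (σ (sizeIndex S) (lab S)).2 (σ (sizeIndex T) (lab T)).2

/-- If two injections induce similar labels, then they become order isomorphic after a
relabelling. -/
lemma exists_relabel {A : Type x} (P : Set ℕ) (lab : Set B → Fin k) {α β : A → B}
    (hα : Function.Injective α) (hβ : Function.Injective β)
    (heq : ∀ S T : Set A, S.ncard = T.ncard →
      (lab (β '' S) = lab (β '' T) ↔ lab (α '' S) = lab (α '' T)))
    (hlt : ∀ S T : Set A, S.ncard = T.ncard → S.ncard ∈ P →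
      (lab (β '' S) < lab (β '' T) ↔ lab (α '' S) < lab (α '' T))) :
    ∃ τ : relabelPerms P (Nat.card B) k, ∀ (σ : relabelPerms P (Nat.card B) k) (S T : Set A),
      blockLabel lab (σ * τ).1 (α '' S) < blockLabel lab (σ * τ).1 (α '' T) ↔
        blockLabel lab σ.1 (β '' S) < blockLabel lab σ.1 (β '' T) := by
  classical
  have hex : ∀ n : Fin (Nat.card B + 1), ∃ π : Equiv.Perm (Fin k),
      ∀ S : {S : Set A // S.ncard = n}, π (lab (α '' S.1)) = lab (β '' S.1) := fun n =>
    exists_perm_apply_eq _ _ fun S T => (heq S.1 T.1 (S.2.trans T.2.symm)).symm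
  choose π hπ using hex
  -- Outside `P` only coincidences of labels are shared, so a permutation carries the labels along
  -- `α` to those along `β`. At sizes in `P` the orders already agree.
  refine ⟨⟨fun n => if (n : ℕ) ∈ P then 1 else π n, fun n hn => if_pos hn⟩, fun σ S T => ?_⟩
  have hcα : ∀ S : Set A, (α '' S).ncard = S.ncard := fun S => Set.ncard_image_of_injective S hα
  have hcβ : ∀ S : Set A, (β '' S).ncard = S.ncard := fun S => Set.ncard_image_of_injective S hβ
  have hidx : ∀ S : Set A, sizeIndex (α '' S) = sizeIndex (β '' S) := fun S =>
    Fin.ext ((hcα S).trans (hcβ S).symm)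
  rw [blockLabel_lt_iff, blockLabel_lt_iff, hcα, hcα, hcβ, hcβ, hidx, hidx]
  refine or_congr Iff.rfl (and_congr_right fun hST => ?_)
  have hval : ∀ S : Set A, (sizeIndex (β '' S) : ℕ) = S.ncard := hcβ
  simp only [Subgroup.coe_mul, Pi.mul_apply, hval, hST, Equiv.Perm.mul_apply]
  by_cases hP : T.ncard ∈ P
  · have hS1 : σ.1 (sizeIndex (β '' S)) = 1 := σ.2 _ (by rw [hval, hST]; exact hP)
    have hT1 : σ.1 (sizeIndex (β '' T)) = 1 := σ.2 _ (by rw [hval]; exact hP)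
    simp only [if_pos hP, hS1, hT1, Equiv.Perm.one_apply]
    exact (hlt S T hST (hST ▸ hP)).symm
  · simp only [if_neg hP]
    rw [hπ _ ⟨S, (hval S).symm⟩, hπ _ ⟨T, (hval T).symm⟩]

/-- If the injections `α i` induce on `A` labels similar to those induced by `α₀`, then there is a
finite family of copies of `B` in a finite labelled set over which the averages of the values at
`α i` are almost the same as those of the values at `α₀`. -/
theorem exists_almost_invariant_family {A : Type x} {ι : Type*} {J : Type*} [Finite A] [Finite J]
    (P : Set ℕ) (lab : Set B → Fin k) {α₀ : A → B} {α : ι → A → B}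
    (hα₀ : Function.Injective α₀) (hα : ∀ i, Function.Injective (α i))
    (heq : ∀ i (S T : Set A), S.ncard = T.ncard →
      (lab (α i '' S) = lab (α i '' T) ↔ lab (α₀ '' S) = lab (α₀ '' T)))
    (hlt : ∀ i (S T : Set A), S.ncard = T.ncard → S.ncard ∈ P →
      (lab (α i '' S) < lab (α i '' T) ↔ lab (α₀ '' S) < lab (α₀ '' T)))
    (C : ℝ) {ε : ℝ} (hε : 0 < ε) :
    ∃ (K : ℕ) (_ : NeZero K), ∀ c : J → (A → Valued B K) → ℝ, (∀ j ρ, |c j ρ| ≤ C) →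
      ∃ (m : ℕ) (_ : 0 < m) (b : Fin m → B → Valued B K), (∀ l, Function.Injective (b l)) ∧
        (∀ l (S T : Set B), S.Nonempty → T.Nonempty → S.ncard = T.ncard →
          ((valuationLabel (b l '' S)).val = (valuationLabel (b l '' T)).val ↔ lab S = lab T) ∧
          (S.ncard ∈ P → ((valuationLabel (b l '' S)).val < (valuationLabel (b l '' T)).val ↔
            lab S < lab T))) ∧
        ∀ i j, |average b (fun β => c j (β ∘ α i)) - average b (fun β => c j (β ∘ α₀))| ≤ ε := by
  classical
  obtain ⟨K₀, hK₀⟩ := exists_bound_strictMono_approx (Set A) J ((Nat.card B + 1) * k) C hε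
  -- All labels used are at most `K₀`, so they survive reduction modulo `K`; the extra one keeps `K`
  -- nonzero.
  let K := K₀ + 1
  refine ⟨K, inferInstance, fun c hc => ?_⟩
  have : Fintype (labelPerms B K) := Fintype.ofFinite _
  have : Fintype (relabelPerms P (Nat.card B) k) := Fintype.ofFinite _
  -- By `labelAverage_eq` the label average along any injection depends only on the labels of
  -- subsets of `A`, so it can be computed along `α₀`.
  let d : (Set A → ℕ) → J → ℝ := fun p j =>
    labelAverage (c j) (valuedCopy (fun S => (p (α₀ ⁻¹' S) : ZMod K)) ∘ α₀)
  obtain ⟨h, hmono, hbound, hh⟩ := hK₀ d fun p j => abs_sum_div_card_le fun θ => hc j _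
  let f : relabelPerms P (Nat.card B) k → Set B → ZMod K := fun σ S => (h (blockLabel lab σ.1 S) : ℕ)
  have hfval : ∀ σ S, (f σ S).val = h (blockLabel lab σ.1 S) := fun σ S =>
    ZMod.val_cast_of_lt ((hbound _ (blockLabel_lt lab σ.1 S)).trans (Nat.lt_succ_self K₀))
  have hd : ∀ {β : A → B}, Function.Injective β → ∀ σ j,
      labelAverage (c j) (valuedCopy (f σ) ∘ β) =
        d (h ∘ fun S => blockLabel lab σ.1 (β '' S)) j := fun {β} hβ σ j => by
    refine labelAverage_eq (c j) hβ hα₀ _ _ fun S _ => ?_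
    rw [Set.preimage_image_eq _ hα₀]
    rfl
  -- The family consists of all translates, under label preserving permutations, of the copies of
  -- `B` for all admissible relabellings.
  let I := relabelPerms P (Nat.card B) k × labelPerms B K
  let e : Fin (Fintype.card I) ≃ I := (Fintype.equivFin I).symm
  let b : Fin (Fintype.card I) → B → Valued B K := fun l => (e l).2.1 ∘ valuedCopy (f (e l).1)
  have havg : ∀ {β : A → B}, Function.Injective β → ∀ j,
      average b (fun ρ => c j (ρ ∘ β)) =
        (∑ σ : relabelPerms P (Nat.card B) k,
          d (h ∘ fun S => blockLabel lab σ.1 (β '' S)) j) /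
          Fintype.card (relabelPerms P (Nat.card B) k) := fun {β} hβ j => by
    have h1 : ∑ l, c j (b l ∘ β) =
        ∑ z : I, c j (z.2.1 ∘ valuedCopy (f z.1) ∘ β) :=
      e.sum_comp fun z : I => c j (z.2.1 ∘ valuedCopy (f z.1) ∘ β)
    have h2 : ∀ σ, d (h ∘ fun S => blockLabel lab σ.1 (β '' S)) j =
        (∑ θ : labelPerms B K, c j (θ.1 ∘ valuedCopy (f σ) ∘ β)) /
          Fintype.card (labelPerms B K) := fun σ => (hd hβ σ j).symm
    rw [average, h1, Fintype.sum_prod_type, Fintype.card_prod]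
    simp only [h2]
    rw [← Finset.sum_div, div_div, Nat.cast_mul, mul_comm]
  have hlabel : ∀ l (S : Set B), S.Nonempty →
      (valuationLabel (b l '' S)).val = h (blockLabel lab (e l).1.1 S) := fun l S hS => by
    have h1 : b l '' S = (e l).2.1 '' (valuedCopy (f (e l).1) '' S) := by
      rw [Set.image_image]
      rfl
    rw [h1, (e l).2.2, valuationLabel_valuedCopy _ hS, hfval]
  have hidx : ∀ {S T : Set B}, S.ncard = T.ncard → sizeIndex S = sizeIndex T := fun h => Fin.ext h
  refine ⟨Fintype.card I, Fintype.card_pos, b,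
    fun l => (e l).2.1.injective.comp (valuedCopy_injective _), fun l S T hS hT hST => ?_,
    fun i j => ?_⟩
  · rw [hlabel l S hS, hlabel l T hT, hmono.injective.eq_iff, hmono.lt_iff_lt]
    refine ⟨?_, fun hP => ?_⟩
    · rw [blockLabel, blockLabel, hST, hidx hST, Nat.add_left_cancel_iff, Fin.val_inj,
        EmbeddingLike.apply_eq_iff_eq]
    · have h1 : (e l).1.1 (sizeIndex T) = 1 := (e l).1.2 _ (show T.ncard ∈ P from hST ▸ hP)
      rw [blockLabel_lt_iff, hidx hST, h1]
      simp [hST]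
  · obtain ⟨τ, hτ⟩ := exists_relabel P lab hα₀ (hα i) (heq i) (hlt i)
    -- Reindexing by `τ` pairs the terms for `α i` and `α₀` so that their labels have equal order
    -- type; each pair then differs by at most `ε`.
    have hre : ∑ σ : relabelPerms P (Nat.card B) k,
          d (h ∘ fun S => blockLabel lab σ.1 (α₀ '' S)) j =
        ∑ σ : relabelPerms P (Nat.card B) k,
          d (h ∘ fun S => blockLabel lab (σ * τ).1 (α₀ '' S)) j :=
      (Equiv.sum_comp (Equiv.mulRight τ) fun σ : relabelPerms P (Nat.card B) k =>
        d (h ∘ fun S => blockLabel lab σ.1 (α₀ '' S)) j).symm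
    rw [havg (hα i), havg hα₀, hre, ← sub_div, ← Finset.sum_sub_distrib]
    refine abs_sum_div_card_le fun σ => ?_
    exact hh _ _ (fun _ => blockLabel_lt _ _ _) (fun _ => blockLabel_lt _ _ _)
      (fun S T => (hτ σ S T).symm) j

end AlmostInvariant

/-! ### Amenability -/

section Labelling

variable {P : Set ℕ} {hP : ∀ n ∈ P, 3 ≤ n} {M : Type w} [Countable M] [(langP P).Structure M]

lemma relE_of_range_eq (hM : IsFraisseLimit (classK.{w} P hP) M) {n : ℕ} (hn : 0 < n)
    {s t : Fin n → M} (hs : Function.Injective s) (ht : Function.Injective t)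
    (h : Set.range s = Set.range t) : relE P n hn s t := by
  let σ : Equiv.Perm (Fin n) :=
    ((Equiv.ofInjective t ht).trans (Equiv.setCongr h.symm)).trans (Equiv.ofInjective s hs).symm
  have : t = s ∘ σ := funext fun i => by
    have h1 : Equiv.ofInjective s hs (σ i) = Equiv.setCongr h.symm (Equiv.ofInjective t ht i) :=
      (Equiv.ofInjective s hs).apply_symm_apply _
    exact (congrArg Subtype.val h1).symm
  rw [this]
  exact (isEquivOnSubsets_of_isFraisseLimit hM n hn).perm s hs σ

/-- Labels for tuples of a fixed length from a finite set. -/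
lemma exists_tuple_label (hM : IsFraisseLimit (classK.{w} P hP) M) {B : Set M} (hB : B.Finite)
    (n : ℕ) (hn : 0 < n) :
    ∃ l : (Fin n → M) → ℕ, ∀ s t, Function.Injective s → Function.Injective t →
      Set.range s ⊆ B → Set.range t ⊆ B →
      (relE P n hn s t ↔ l s = l t) ∧ ∀ hn' : n ∈ P, relLt P n hn' s t ↔ l s < l t := by
  have hE := isEquivOnSubsets_of_isFraisseLimit hM n hn
  by_cases hn' : n ∈ P
  · have hlo := isLinearOrderOnClasses_of_isFraisseLimit hM n hn' hn
    -- For ordered classes the label of `s` is the number of tuples from `B` below it.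
    let D : (Fin n → M) → Set (Fin n → M) := fun s => {r | Set.range r ⊆ B ∧ relLt P n hn' r s}
    have hfin : ∀ s, (D s).Finite := fun s => by
      refine (Set.Finite.pi' (t := fun _ : Fin n => B) fun _ => hB).subset fun r hr i => ?_
      exact hr.1 (Set.mem_range_self i)
    have hEl : ∀ s t, relE P n hn s t → (D s).ncard = (D t).ncard := fun s t hst => by
      have : D s = D t := Set.ext fun r => and_congr_right fun _ =>
        ⟨fun h => hlo.respects _ _ _ _ (hE.perm r (hlo.inj _ _ h).1 1) hst h,
          fun h => hlo.respects _ _ _ _ (hE.perm r (hlo.inj _ _ h).1 1) (hE.symm _ _ hst) h⟩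
      rw [this]
    have hltl : ∀ s t, Set.range s ⊆ B → relLt P n hn' s t → (D s).ncard < (D t).ncard :=
      fun s t hs hst => by
        refine Set.ncard_lt_ncard ?_ (hfin t)
        have hsub : D s ⊆ D t := fun r hr => ⟨hr.1, hlo.trans _ _ _ hr.2 hst⟩
        exact (Set.ssubset_iff_of_subset hsub).2
          ⟨s, ⟨hs, hst⟩, fun h => not_relLt_self hM hn' s h.2⟩
    refine ⟨fun s => (D s).ncard, fun s t hs ht hsB htB => ?_⟩
    have htri : relE P n hn s t ∨ relLt P n hn' s t ∨ relLt P n hn' t s := by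
      by_cases h : relE P n hn s t
      · exact Or.inl h
      · exact Or.inr (hlo.total s t hs ht h)
    refine ⟨⟨hEl s t, fun h => ?_⟩, fun _ => ⟨hltl s t hsB, fun h => ?_⟩⟩
    · rcases htri with h1 | h1 | h1
      · exact h1
      · exact absurd h (hltl s t hsB h1).ne
      · exact absurd h (hltl t s htB h1).ne'
    · rcases htri with h1 | h1 | h1
      · exact absurd (hEl s t h1) h.ne
      · exact h1
      · exact absurd (hltl t s htB h1) h.not_gt
  · let E : Setoid {s : Fin n → M // Function.Injective s} :=
      { r := fun s t => relE P n hn s.1 t.1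
        iseqv := ⟨fun s => hE.perm s.1 s.2 1, hE.symm _ _, hE.trans _ _ _⟩ }
    obtain ⟨q, hq⟩ := exists_injective_nat (Quotient E)
    classical
    refine ⟨fun s => if hs : Function.Injective s then q (Quotient.mk E ⟨s, hs⟩) else 0,
      fun s t hs ht _ _ => ⟨?_, fun h => absurd h hn'⟩⟩
    simp only [dif_pos hs, dif_pos ht, hq.eq_iff, Quotient.eq]
    rfl

/-- The relations between tuples from a finite set are coded by labels of the subsets. -/
theorem exists_label (hM : IsFraisseLimit (classK.{w} P hP) M) {B : Set M} (hB : B.Finite) :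
    ∃ (k : ℕ) (lab : Set B → Fin k), ∀ (n : ℕ) (s t : Fin n → B),
      Function.Injective s → Function.Injective t →
      (∀ hn : 0 < n, relE P n hn (Subtype.val ∘ s) (Subtype.val ∘ t) ↔
        lab (Set.range s) = lab (Set.range t)) ∧
      ∀ hn : n ∈ P, relLt P n hn (Subtype.val ∘ s) (Subtype.val ∘ t) ↔
        lab (Set.range s) < lab (Set.range t) := by
  classical
  have := hB.to_subtype
  choose l hl using exists_tuple_label hM hB
  let lab : Set B → ℕ := fun S =>
    if h : ∃ z : Σ n, Fin n → B, 0 < z.1 ∧ Function.Injective z.2 ∧ Set.range z.2 = S then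
      l h.choose.1 h.choose_spec.1 (Subtype.val ∘ h.choose.2) else 0
  have hval : ∀ (n : ℕ) (s : Fin n → B), Set.range (Subtype.val ∘ s) ⊆ B := fun n s => by
    rintro _ ⟨i, rfl⟩
    exact (s i).2
  have hlab : ∀ (n : ℕ) (hn : 0 < n) (s : Fin n → B), Function.Injective s →
      lab (Set.range s) = l n hn (Subtype.val ∘ s) := fun n hn s hs => by
    have h : ∃ z : Σ n, Fin n → B, 0 < z.1 ∧ Function.Injective z.2 ∧ Set.range z.2 = Set.range s :=
      ⟨⟨n, s⟩, hn, hs, rfl⟩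
    simp only [lab, dif_pos h]
    obtain ⟨hpos, hinj, hrange⟩ := h.choose_spec
    generalize h.choose = z at hpos hinj hrange
    obtain ⟨m, z⟩ := z
    obtain rfl : m = n := by
      have := congrArg Set.ncard hrange
      rwa [← Nat.card_coe_set_eq, ← Nat.card_coe_set_eq, Nat.card_range_of_injective hinj,
        Nat.card_range_of_injective hs, Nat.card_fin, Nat.card_fin] at this
    -- The label was read off a chosen enumeration of the set; another enumeration is
    -- `E_m`-equivalent and so has the same label.
    refine ((hl m hn _ _ (Subtype.val_injective.comp hinj) (Subtype.val_injective.comp hs)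
      (hval _ _) (hval _ _)).1).1 (relE_of_range_eq hM hn (Subtype.val_injective.comp hinj)
        (Subtype.val_injective.comp hs) ?_)
    rw [Set.range_comp, Set.range_comp]
    exact congrArg _ hrange
  obtain ⟨k, hk⟩ : ∃ k, ∀ S, lab S < k := by
    obtain ⟨k, hk⟩ := (Set.finite_range lab).bddAbove
    exact ⟨k + 1, fun S => Nat.lt_succ_of_le (hk (Set.mem_range_self S))⟩
  refine ⟨k, fun S => ⟨lab S, hk S⟩, fun n s t hs ht => ?_⟩
  have key := fun hn => hl n hn _ _ (Subtype.val_injective.comp hs) (Subtype.val_injective.comp ht)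
    (hval _ s) (hval _ t)
  refine ⟨fun hn => ?_, fun hn => ?_⟩
  · rw [(key hn).1, Fin.mk_eq_mk, hlab n hn s hs, hlab n hn t ht]
  · have hn' : 0 < n := Nat.lt_of_lt_of_le (by decide) (hP n hn)
    rw [(key hn').2 hn, Fin.mk_lt_mk, hlab n hn' s hs, hlab n hn' t ht]

end Labelling

/-! ### From copies of finite sets to points of a flow -/

section Amenable

open CompactlySupported

/-- The subbasic sets constrain one value each, so a basic neighbourhood of `g` constrains finitely
many. -/
lemma exists_finset_forall_mem_of_isOpen {L : FirstOrder.Language.{u, v}} {M : Type w}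
    [L.Structure M] {U : Set (Aut L M)} (hU : IsOpen U) :
    ∀ g ∈ U, ∃ A : Finset M, ∀ h : Aut L M, (∀ a ∈ A, h a = g a) → h ∈ U := by
  classical
  induction hU with
  | basic V hV =>
    obtain ⟨a, b, rfl⟩ := hV
    intro g hg
    exact ⟨{a}, fun h hh => (hh a (Finset.mem_singleton_self a)).trans hg⟩
  | univ => exact fun _ _ => ⟨∅, fun _ _ => trivial⟩
  | inter V W _ _ hV hW =>
    intro g hg
    obtain ⟨A, hA⟩ := hV g hg.1
    obtain ⟨B, hB⟩ := hW g hg.2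
    exact ⟨A ∪ B, fun h hh => ⟨hA h fun a ha => hh a (Finset.mem_union_left _ ha),
      hB h fun a ha => hh a (Finset.mem_union_right _ ha)⟩⟩
  | sUnion 𝒱 _ ih =>
    rintro g ⟨V, hV, hg⟩
    obtain ⟨A, hA⟩ := ih V hV g hg
    exact ⟨A, fun h hh => ⟨V, hV, hA h hh⟩⟩

/-- A continuous function on a flow is almost invariant under the stabilizer of a finite set. -/
lemma exists_finset_forall_abs_sub_le {L : FirstOrder.Language.{u, v}} {M : Type w} [L.Structure M]
    {X : Type x} [TopologicalSpace X] [CompactSpace X] [MulAction (Aut L M) X]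
    [ContinuousSMul (Aut L M) X] (f : X → ℝ) (hf : Continuous f) {ε : ℝ} (hε : 0 < ε) :
    ∃ A : Finset M, ∀ g : Aut L M, (∀ a ∈ A, g a = a) → ∀ p : X, |f (g • p) - f p| ≤ ε := by
  let W : Set (Aut L M × X) := {z | |f (z.1 • z.2) - f z.2| < ε}
  have hW : IsOpen W := by
    refine isOpen_lt ?_ continuous_const
    exact ((hf.comp continuous_smul).sub (hf.comp continuous_snd)).abs
  have hsub : ({1} : Set (Aut L M)) ×ˢ (Set.univ : Set X) ⊆ W := by
    rintro ⟨g, p⟩ ⟨hg, -⟩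
    have hg : g = 1 := hg
    simp [W, hg, hε]
  obtain ⟨U, V, hU, -, h1U, hV, hUV⟩ :=
    generalized_tube_lemma isCompact_singleton isCompact_univ hW hsub
  obtain ⟨A, hA⟩ := exists_finset_forall_mem_of_isOpen hU 1 (h1U rfl)
  exact ⟨A, fun g hg p => (hUV (Set.mk_mem_prod (hA g hg) (hV (Set.mem_univ p))) :
    (g, p) ∈ W).le⟩

lemma exists_tuple_range_eq {A : Type*} [Finite A] (S : Set A) {n : ℕ} (hS : S.ncard = n) :
    ∃ s : Fin n → A, Function.Injective s ∧ Set.range s = S := by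
  subst hS
  have e : S ≃ Fin S.ncard := Finite.equivFinOfCardEq (Nat.card_coe_set_eq S)
  refine ⟨Subtype.val ∘ e.symm, Subtype.val_injective.comp e.symm.injective, ?_⟩
  rw [Set.range_comp, e.symm.surjective.range_eq, Set.image_univ, Subtype.range_coe]

variable {P : Set ℕ} {M : Type w} [(langP P).Structure M]

/-- The labels induced by an automorphism are similar to those induced by the identity. -/
lemma label_image_iff {A B : Type w} [Finite A] [Finite B] (v : B → M)
    {k : ℕ} (lab : Set B → Fin k)
    (hlab : ∀ (n : ℕ) (s t : Fin n → B), Function.Injective s → Function.Injective t →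
      (∀ hn : 0 < n, relE P n hn (v ∘ s) (v ∘ t) ↔ lab (Set.range s) = lab (Set.range t)) ∧
      ∀ hn : n ∈ P, relLt P n hn (v ∘ s) (v ∘ t) ↔ lab (Set.range s) < lab (Set.range t))
    {α β : A → B} (hα : Function.Injective α) (hβ : Function.Injective β) (g : Aut (langP P) M)
    (hg : ∀ a, v (β a) = g (v (α a))) (S T : Set A) (hST : S.ncard = T.ncard) :
    (lab (β '' S) = lab (β '' T) ↔ lab (α '' S) = lab (α '' T)) ∧
      (S.ncard ∈ P → (lab (β '' S) < lab (β '' T) ↔ lab (α '' S) < lab (α '' T))) := by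
  obtain ⟨s, hs, hsS⟩ := exists_tuple_range_eq S rfl
  obtain ⟨t, ht, htT⟩ := exists_tuple_range_eq T hST.symm
  have hβg : ∀ s : Fin S.ncard → A, v ∘ β ∘ s = g.toEmbedding ∘ v ∘ α ∘ s := fun s =>
    funext fun i => hg (s i)
  have hr : ∀ (γ : A → B) (s : Fin S.ncard → A) (S : Set A), Set.range s = S →
      γ '' S = Set.range (γ ∘ s) := fun γ s S h => by rw [← h, Set.range_comp]
  rw [hr β s S hsS, hr β t T htT, hr α s S hsS, hr α t T htT]
  have h1 := hlab _ (β ∘ s) (β ∘ t) (hβ.comp hs) (hβ.comp ht)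
  have h2 := hlab _ (α ∘ s) (α ∘ t) (hα.comp hs) (hα.comp ht)
  refine ⟨?_, fun hn => ?_⟩
  · rcases Nat.eq_zero_or_pos S.ncard with h0 | h0
    · have : IsEmpty (Fin S.ncard) := by rw [h0]; infer_instance
      simp [Set.range_eq_empty]
    · rw [← h1.1 h0, ← h2.1 h0, hβg, hβg, relE_embedding]
  · rw [← h1.2 hn, ← h2.2 hn, hβg, hβg, relLt_embedding]

/-- Almost constant functions on cosets of a stabilizer come from functions of tuples. -/
lemma exists_tuple_function {X : Type x} [MulAction (Aut (langP P) M) X] (p₀ : X) (f : X → ℝ)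
    {A : Finset M} {ε C : ℝ} (hC : 0 ≤ C) (hfC : ∀ p, |f p| ≤ C)
    (hA : ∀ g : Aut (langP P) M, (∀ a ∈ A, g a = a) → ∀ p : X, |f (g • p) - f p| ≤ ε) :
    ∃ c : (A → M) → ℝ, (∀ ρ, |c ρ| ≤ C) ∧
      ∀ (g : Aut (langP P) M) (ρ : A → M), (∀ a : A, g a = ρ a) →
        |f (g⁻¹ • p₀) - c ρ| ≤ ε := by
  classical
  refine ⟨fun ρ => if h : ∃ g : Aut (langP P) M, ∀ a : A, g a = ρ a then f (h.choose⁻¹ • p₀) else 0,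
    fun ρ => ?_, fun g ρ hg => ?_⟩
  · dsimp only
    split_ifs
    · exact hfC _
    · rwa [abs_zero]
  · have hex : ∃ g : Aut (langP P) M, ∀ a : A, g a = ρ a := ⟨g, hg⟩
    dsimp only
    rw [dif_pos hex]
    -- Two automorphisms agreeing on `A` differ by an element fixing `A` pointwise. It acts on the
    -- left of the inverses, which is why points of the form `g⁻¹ • p₀` are used.
    have h1 := hA (g⁻¹ * hex.choose) (fun a ha => by
      change g⁻¹ (hex.choose a) = a
      rw [hex.choose_spec ⟨a, ha⟩, ← hg ⟨a, ha⟩]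
      exact g.symm_apply_apply a) (hex.choose⁻¹ • p₀)
    rwa [mul_smul, smul_inv_smul] at h1

lemma abs_average_sub_le {X Y : Type*} {m : ℕ} (hm : 0 < m) (y : Fin m → X) (z : Fin m → Y)
    (f : X → ℝ) (g : Y → ℝ) {ε : ℝ} (h : ∀ i, |f (y i) - g (z i)| ≤ ε) :
    |average y f - average z g| ≤ ε := by
  have hpos : (0 : ℝ) < m := Nat.cast_pos.2 hm
  rw [average, average, ← sub_div, ← Finset.sum_sub_distrib, abs_div, abs_of_pos hpos,
    div_le_iff₀ hpos]
  calc |∑ i, (f (y i) - g (z i))| ≤ ∑ i, |f (y i) - g (z i)| := Finset.abs_sum_le_sum_abs _ _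
    _ ≤ ∑ _i : Fin m, ε := Finset.sum_le_sum fun i _ => h i
    _ = ε * m := by simp [mul_comm]

variable {hP : ∀ n ∈ P, 3 ≤ n} [Countable M]

/-- Copies of a finite set with the right labels are images under automorphisms. -/
lemma exists_aut_of_label (hM : IsFraisseLimit (classK.{w} P hP) M) {B V : Type*} [Finite B]
    {v : B → M} (hv : Function.Injective v) {k : ℕ} (lab : Set B → Fin k)
    (hlab : ∀ (n : ℕ) (s t : Fin n → B), Function.Injective s → Function.Injective t →
      (∀ hn : 0 < n, relE P n hn (v ∘ s) (v ∘ t) ↔ lab (Set.range s) = lab (Set.range t)) ∧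
      ∀ hn : n ∈ P, relLt P n hn (v ∘ s) (v ∘ t) ↔ lab (Set.range s) < lab (Set.range t))
    (labV : Set V → ℕ) {e : V → M} (he : Function.Injective e)
    (heE : ∀ (n : ℕ) (hn : 0 < n) (s t : Fin n → V), relE P n hn (e ∘ s) (e ∘ t) ↔
      Function.Injective s ∧ Function.Injective t ∧ labV (Set.range s) = labV (Set.range t))
    (helt : ∀ (n : ℕ) (hn : n ∈ P) (s t : Fin n → V), relLt P n hn (e ∘ s) (e ∘ t) ↔
      Function.Injective s ∧ Function.Injective t ∧ labV (Set.range s) < labV (Set.range t))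
    {b : B → V} (hb : Function.Injective b)
    (hbl : ∀ S T : Set B, S.Nonempty → T.Nonempty → S.ncard = T.ncard →
      (labV (b '' S) = labV (b '' T) ↔ lab S = lab T) ∧
      (S.ncard ∈ P → (labV (b '' S) < labV (b '' T) ↔ lab S < lab T))) :
    ∃ g : Aut (langP P) M, ∀ p, g (v p) = e (b p) := by
  have hcard : ∀ {n : ℕ} {s : Fin n → B}, Function.Injective s → (Set.range s).ncard = n :=
    fun hs => by rw [← Nat.card_coe_set_eq, Nat.card_range_of_injective hs, Nat.card_fin]
  have key : ∀ {n : ℕ} (s t : Fin n → B), 0 < n → Function.Injective s → Function.Injective t →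
      (labV (Set.range (b ∘ s)) = labV (Set.range (b ∘ t)) ↔
        lab (Set.range s) = lab (Set.range t)) ∧
      (n ∈ P → (labV (Set.range (b ∘ s)) < labV (Set.range (b ∘ t)) ↔
        lab (Set.range s) < lab (Set.range t))) := fun {n} s t hn hs ht => by
    have : Nonempty (Fin n) := ⟨⟨0, hn⟩⟩
    have h := hbl (Set.range s) (Set.range t) (Set.range_nonempty s) (Set.range_nonempty t)
      ((hcard hs).trans (hcard ht).symm)
    rwa [← Set.range_comp, ← Set.range_comp, hcard hs] at h
  refine exists_aut_of_relMap_iff hM.ultrahomogeneous v (e ∘ b) hv (he.comp hb)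
    (relMap_comp_iff (fun n hn s t => ?_) fun n hn s t => ?_)
  · have hinj := (isEquivOnSubsets_of_isFraisseLimit hM n hn).inj
    rw [Function.comp_assoc, Function.comp_assoc, heE, hb.of_comp_iff, hb.of_comp_iff]
    refine ⟨fun h => ?_, fun ⟨hs, ht, h⟩ => ?_⟩
    · have hs := (hinj _ _ h).1.of_comp
      have ht := (hinj _ _ h).2.of_comp
      exact ⟨hs, ht, (key s t hn hs ht).1.2 (((hlab n s t hs ht).1 hn).1 h)⟩
    · exact ((hlab n s t hs ht).1 hn).2 ((key s t hn hs ht).1.1 h)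
  · have hn' : 0 < n := Nat.lt_of_lt_of_le (by decide) (hP n hn)
    have hinj := (isLinearOrderOnClasses_of_isFraisseLimit hM n hn hn').inj
    rw [Function.comp_assoc, Function.comp_assoc, helt, hb.of_comp_iff, hb.of_comp_iff]
    refine ⟨fun h => ?_, fun ⟨hs, ht, h⟩ => ?_⟩
    · have hs := (hinj _ _ h).1.of_comp
      have ht := (hinj _ _ h).2.of_comp
      exact ⟨hs, ht, ((key s t hn' hs ht).2 hn).2 (((hlab n s t hs ht).2 hn).1 h)⟩
    · exact ((hlab n s t hs ht).2 hn).2 (((key s t hn' hs ht).2 hn).1 h)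

/-- The averages of `f (s • ·)` and `f` over the points `(g l)⁻¹ • p₀` are replaced, at cost `ε / 3`
each, by averages of a function of the copies of `s⁻¹ A` and `A`; these differ by at most `ε / 3`.
-/
theorem exists_almost_invariant_points (hM : IsFraisseLimit (classK.{w} P hP) M) {X : Type x}
    [TopologicalSpace X] [CompactSpace X] [Nonempty X] [MulAction (Aut (langP P) M) X]
    [ContinuousSMul (Aut (langP P) M) X] (F : Finset (Aut (langP P) M)) (Φ : Finset C_c(X, ℝ))
    (ε : ℝ) (hε : 0 < ε) :
    ∃ (m : ℕ) (_ : 0 < m) (y : Fin m → X), ∀ s ∈ F, ∀ f ∈ Φ,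
      |average y (fun p => f (s • p)) - average y f| ≤ ε := by
  classical
  obtain ⟨p₀⟩ := ‹Nonempty X›
  have hε3 : 0 < ε / 3 := by positivity
  have hbdd : ∀ f : C_c(X, ℝ), ∃ C : ℝ, ∀ p, |f p| ≤ C := fun f => by
    obtain ⟨C, hC⟩ := (isCompact_range (map_continuous f)).isBounded.exists_norm_le
    exact ⟨C, fun p => hC _ (Set.mem_range_self p)⟩
  choose C₀ hC₀ using hbdd
  have hC₀' : ∀ f, 0 ≤ C₀ f := fun f => (abs_nonneg _).trans (hC₀ f p₀)
  let C : ℝ := ∑ f ∈ Φ, C₀ f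
  have hC : ∀ f ∈ Φ, ∀ p, |f p| ≤ C := fun f hf p =>
    (hC₀ f p).trans (Finset.single_le_sum (f := C₀) (fun f _ => hC₀' f) hf)
  have hC' : 0 ≤ C := Finset.sum_nonneg fun f _ => hC₀' f
  have hunif : ∀ f : C_c(X, ℝ), ∃ A : Finset M, ∀ g : Aut (langP P) M, (∀ a ∈ A, g a = a) →
      ∀ p : X, |f (g • p) - f p| ≤ ε / 3 := fun f =>
    exists_finset_forall_abs_sub_le f (map_continuous f) hε3
  choose A₀ hA₀ using hunif
  let A : Finset M := Φ.biUnion A₀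
  have hA : ∀ f ∈ Φ, ∀ g : Aut (langP P) M, (∀ a ∈ A, g a = a) →
      ∀ p : X, |f (g • p) - f p| ≤ ε / 3 := fun f hf g hg =>
    hA₀ f g fun a ha => hg a (Finset.mem_biUnion.2 ⟨f, hf, ha⟩)
  -- Since `s • g⁻¹ • p₀ = (g * s⁻¹)⁻¹ • p₀`, the restriction of `g` to `s⁻¹ A` is what matters for
  -- the translate by `s`.
  let B : Set M := (A : Set M) ∪ ⋃ s ∈ F, (fun a => s⁻¹ a) '' (A : Set M)
  have hB : B.Finite :=
    A.finite_toSet.union (F.finite_toSet.biUnion fun s _ => A.finite_toSet.image _)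
  have := hB.to_subtype
  obtain ⟨k, lab, hlab⟩ := exists_label hM hB
  let α₀ : A → B := fun a => ⟨a, Or.inl a.2⟩
  let α : F → A → B := fun s a => ⟨s.1⁻¹ a,
    Or.inr (Set.mem_biUnion s.2 (Set.mem_image_of_mem _ a.2))⟩
  have hα₀ : Function.Injective α₀ := fun a b h => Subtype.ext (Subtype.mk.inj h)
  have hα : ∀ s, Function.Injective (α s) := fun s a b h =>
    Subtype.ext ((s.1⁻¹).injective (congrArg Subtype.val h))
  have hsim := fun s : F => label_image_iff (A := A) (B := B) Subtype.val lab hlab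
    hα₀ (hα s) s.1⁻¹ fun a => rfl
  obtain ⟨K, _, hK⟩ := exists_almost_invariant_family (J := Φ) P lab hα₀ hα
    (fun s S T h => (hsim s S T h).1) (fun s S T h => (hsim s S T h).2) C hε3
  obtain ⟨e, he, heE, helt⟩ := exists_labelled_embedding hM
    fun T : Set (Valued B K) => (valuationLabel T).val
  have hcex : ∀ f : Φ, _ := fun f =>
    exists_tuple_function p₀ f.1 (A := A) (ε := ε / 3) hC' (hC f.1 f.2) (hA f.1 f.2)
  choose c hcC hc using hcex
  obtain ⟨m, hm, b, hb, hbl, havg⟩ := hK (fun f ρ => c f (e ∘ ρ)) fun f ρ => hcC f _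
  have hg : ∀ l, ∃ g : Aut (langP P) M, ∀ p : B, g p = e (b l p) := fun l =>
    exists_aut_of_label hM Subtype.val_injective lab hlab
      (fun T : Set (Valued B K) => (valuationLabel T).val) he heE helt (hb l) (hbl l)
  choose g hg using hg
  refine ⟨m, hm, fun l => (g l)⁻¹ • p₀, fun s hs f hf => ?_⟩
  have h1 : |average (fun l => (g l)⁻¹ • p₀) (fun p => f (s • p)) -
      average b (fun β => c ⟨f, hf⟩ (e ∘ β ∘ α ⟨s, hs⟩))| ≤ ε / 3 := by
    refine abs_average_sub_le hm _ _ _ _ fun l => ?_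
    have := hc ⟨f, hf⟩ (g l * s⁻¹) (e ∘ b l ∘ α ⟨s, hs⟩) fun a => hg l (α ⟨s, hs⟩ a)
    rwa [mul_inv_rev, inv_inv, mul_smul] at this
  have h2 : |average (fun l => (g l)⁻¹ • p₀) f -
      average b (fun β => c ⟨f, hf⟩ (e ∘ β ∘ α₀))| ≤ ε / 3 :=
    abs_average_sub_le hm _ _ _ _ fun l => hc ⟨f, hf⟩ (g l) _ fun a => hg l (α₀ a)
  have h3 := havg ⟨s, hs⟩ ⟨f, hf⟩
  rw [abs_le] at h1 h2 h3 ⊢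
  constructor <;> linarith [h1.1, h1.2, h2.1, h2.2, h3.1, h3.2]

theorem isAmenable_aut (hM : IsFraisseLimit (classK.{w} P hP) M) :
    IsAmenable.{w, x} (Aut (langP P) M) := by
  intro X _ _ _ _ _ _ _ _
  exact exists_invariant_measure (fun g => continuous_const_smul g)
    (exists_almost_invariant_points hM)

end Amenable

end GenericOrders

theorem theorem2 (P : Set ℕ) (hP : ∀ n ∈ P, 3 ≤ n) (hne : P.Nonempty)
    (M : Type w) [Countable M] [(langP P).Structure M]
    (hM : IsFraisseLimit (classK.{w} P hP) M) :
    IsAmenable.{w, x} (Aut (langP P) M) ∧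
    ¬ HrushovskiExtension (langP P) M ∧
    (¬ ∃ o : LinearOrder M,
      letI := orderExpansion (langP P) M o
      ((langP P).sum FirstOrder.Language.order).IsUltrahomogeneous M ∧
        IsExtremelyAmenable.{w, x} (Aut ((langP P).sum FirstOrder.Language.order) M)) ∧
    (∀ (L' : FirstOrder.Language.{u, v}) [L'.IsRelational] [L'.Structure M]
      (φ : langP P →ᴸ L') [φ.IsExpansionOn M],
      IsPrecompactExpansion φ M → HasQE L' M → IsExtremelyAmenable.{w, x} (Aut L' M) →
      ∀ (n : ℕ) (hn : n ∈ P), 2 * n ∉ P →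
        ¬ ∃ a : Fin 6 → (Fin n → M),
          IsIncreasingZ4 P L' n (Nat.lt_of_lt_of_le (by decide) (hP n hn)) a) := by
  exact ⟨isAmenable_aut hM, not_hrushovskiExtension hne hM, not_exists_linearOrder hM,
    fun L' _ _ φ _ hpre hqe hG n hn _ => not_exists_isIncreasingZ4 hM φ hpre hqe hG n _⟩
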